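/- Let $\mathbb D$ be the open unit disk. For functions $g,h$ on $\mathbb D$ write $g\prec h$ if $g=h\circ w$ on $\mathbb D$ for some analytic $w:\mathbb D\to\mathbb D$ with $w(0)=0$. Let $\mathcal A$ be the class of analytic functions $f(z)=z+\sum_{m\ge2}a_mz^m$ on $\mathbb D$. A convex function is an injective analytic function on $\mathbb D$ whose image is convex; a Carathéodory function is an analytic $q$ on $\mathbb D$ with $q(0)=1$ and $\operatorname{Re}q>0$. The logarithmic coefficients $\gamma_m$ of $f$ are defined by $\log\frac{f(z)}{z}=2\sum_{m\ge1}\gamma_mz^m$ on $\mathbb D$. **Theorem.** Let $\phi(z)=1+B_1z+B_2z^2+\cdots$ be a convex function with $\operatorname{Re}\phi>0$ on $\mathbb D$ and $B_1\ne0$. Put $\psi(z)=\frac1z\int_0^z\phi(t)\,dt$ (with $\psi(0)=1$), and let $\sqrt\psi$ be the principal square root. 1. $\psi$ is a convex function and a Carathéodory function, and $\sqrt\psi$ is an injective Carathéodory function. 2. If $f\in\mathcal A$ satisfies $$\frac{zf'(z)}{f(z)}\left(\frac{zf'(z)}{f(z)}+2z\left(\frac{zf'(z)}{f(z)}\right)'\right)\prec\phi(z),$$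 then $\frac{zf'(z)}{f(z)}\prec\sqrt{\psi(z)}$, the logarithmic coefficients of $f$ exist, and $$2\sum_{m=1}^\infty|\gamma_m|r^m\le1\qquad\text{for }0\le r\le 1-\exp\left(-\frac4{|B_1|}\right).$$ 3. There is $f_0\in\mathcal A$ with $\frac{zf_0'(z)}{f_0(z)}=\sqrt{\psi(z)}$ on $\mathbb D$, and it satisfies the subordination in 2. If such an $f_0$ is extremal in the sense that its logarithmic coefficients satisfy $|\gamma_m|=\frac{|B_1|}{8m}$ for every $m\ge1$, then the radius is sharp: $2\sum_{m\ge1}|\gamma_m|r^m>1$ whenever $1-\exp(-4/|B_1|)<r<1$. -/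

import Mathlib

open Complex Set

/-- The open unit disk. -/
def unitDisk : Set ℂ := Metric.ball 0 1

/-- `w` is a Schwarz function: an analytic self-map of the unit disk fixing the origin. -/
def IsSchwarz (w : ℂ → ℂ) : Prop :=
  DifferentiableOn ℂ w unitDisk ∧ w 0 = 0 ∧ ∀ z ∈ unitDisk, w z ∈ unitDisk

/-- Subordination `g ≺ h` on the unit disk: `g = h ∘ w` for a Schwarz function `w`. -/
def Subordinate (g h : ℂ → ℂ) : Prop :=
  ∃ w : ℂ → ℂ, IsSchwarz w ∧ ∀ z ∈ unitDisk, g z = h (w z)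

/-- `φ` is a convex (univalent) function: analytic and injective on the unit disk, with convex
image. -/
def IsConvexFunction (φ : ℂ → ℂ) : Prop :=
  DifferentiableOn ℂ φ unitDisk ∧ InjOn φ unitDisk ∧ Convex ℝ (φ '' unitDisk)

/-- `q` is a (normalized) Carathéodory function. -/
def IsCaratheodory (q : ℂ → ℂ) : Prop :=
  DifferentiableOn ℂ q unitDisk ∧ q 0 = 1 ∧ ∀ z ∈ unitDisk, 0 < (q z).re

/-- The class `𝒜` of analytic functions `f(z) = z + a₂ z² + ⋯` on the unit disk. -/
def ClassA (f : ℂ → ℂ) : Prop :=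
  DifferentiableOn ℂ f unitDisk ∧ f 0 = 0 ∧ deriv f 0 = 1

/-- The function `z f'(z) / f(z)`, with its removable singularity at the origin filled in
(for `f ∈ 𝒜` the limit there is `1`). -/
noncomputable def starQuot (f : ℂ → ℂ) (z : ℂ) : ℂ :=
  if z = 0 then 1 else z * deriv f z / f z

/-- The expression `p (p + 2 z p')` for `p(z) = z f'(z) / f(z)`. -/
noncomputable def diffExpr (f : ℂ → ℂ) (z : ℂ) : ℂ :=
  starQuot f z * (starQuot f z + 2 * z * deriv (starQuot f) z)

/-- The integral mean `(1/z) ∫₀ᶻ φ(ζ) dζ`, where the integral is taken along the segment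
`ζ = t z`, `0 ≤ t ≤ 1`; the factor `z` of `dζ = z dt` cancels, and the value at `0` is `φ 0`. -/
noncomputable def integralMean (φ : ℂ → ℂ) (z : ℂ) : ℂ :=
  ∫ t in (0 : ℝ)..1, φ ((t : ℂ) * z)

/-- The principal square root of the integral mean of `φ`. -/
noncomputable def sqrtMean (φ : ℂ → ℂ) (z : ℂ) : ℂ :=
  integralMean φ z ^ (1 / 2 : ℂ)

/-- `γ` (with `γ m` relevant for `m ≥ 1`) is the sequence of logarithmic coefficients of `f`:
`log (f(z)/z) = 2 ∑_{m ≥ 1} γ m z^m` on the unit disk. The branch `L` of the logarithm is the sum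
of this power series, hence analytic with `L 0 = 0`. -/
def IsLogCoeffs (f : ℂ → ℂ) (γ : ℕ → ℂ) : Prop :=
  ∃ L : ℂ → ℂ, (∀ z ∈ unitDisk, f z = z * exp (L z)) ∧
    ∀ z ∈ unitDisk, HasSum (fun m : ℕ => 2 * γ (m + 1) * z ^ (m + 1)) (L z)

open Filter Topology Metric

/-! Put `P = z f'/f` and `u = P²`. The hypothesis says `u + z u' = φ ∘ w` with `w` a Schwarz
function, while the mean `ψ` solves `ψ + z ψ' = φ`. Everything rests on comparing these two
equations.

Convexity of `φ` is used in the form `Re ((φ z - φ (x z)) / (z φ' z)) ≥ 0` for `‖x‖ ≤ 1`. Averaging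
over `x = t ∈ [0, 1]` gives `Re (ψ'/φ') ≥ 0`, made strict by the maximum principle, hence
injectivity of `ψ`. The same quotient `q` formed with `ψ` satisfies `q + (ψ'/φ') z q' = (φ z - φ (x
z)) / (z φ' z)`, so a minimum principle gives `Re q ≥ 0` and `ψ` is convex. If `ψ⁻¹ ∘ u` violated
the Schwarz bound, Jack's lemma would give a point contradicting the strict form of the inequality
for `φ`; hence `u ≺ ψ`, and the principal root gives `P ≺ √ψ`.

The Bohr inequality is a mean-square argument. With `b = |B₁|`, Rogosinski's theorem for `φ ∘ w`
bounds the coefficients of `P²` by `b / (n + 1)`. Parseval for `P` and `P²`, with Cauchy–Schwarz on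
circles, gives `∑_{n ≥ 1} |a_n|² ≤ √(1 + (π²/6 - 1) b²) - 1` for the coefficients of `P`. Since `a_n
= 2 n γ_n`, another Cauchy–Schwarz bounds `(2 ∑ |γ_n| r^n)²` by this times `∑ r^{2n}/n²`. As `b ≤
2`, a numerical check on three ranges of `b` shows that the product is at most one. For sharpness,
coefficients of modulus `b/(8m)` sum to a logarithm. -/

theorem mem_unitDisk {z : ℂ} : z ∈ unitDisk ↔ ‖z‖ < 1 := mem_ball_zero_iff

theorem isOpen_unitDisk : IsOpen unitDisk := isOpen_ball

theorem zero_mem_unitDisk : (0 : ℂ) ∈ unitDisk := by simp [mem_unitDisk]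

theorem mul_mem_unitDisk {x z : ℂ} (hx : ‖x‖ ≤ 1) (hz : z ∈ unitDisk) : x * z ∈ unitDisk := by
  rw [mem_unitDisk] at *
  rw [norm_mul]
  exact (mul_le_of_le_one_left (norm_nonneg _) hx).trans_lt hz

theorem mem_unitDisk_of_norm_le {z w : ℂ} (h : ‖z‖ ≤ ‖w‖) (hw : w ∈ unitDisk) : z ∈ unitDisk :=
  mem_unitDisk.2 (h.trans_lt (mem_unitDisk.1 hw))

theorem DifferentiableOn.differentiableAt_unitDisk {f : ℂ → ℂ} (hf : DifferentiableOn ℂ f unitDisk)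
    {z : ℂ} (hz : z ∈ unitDisk) : DifferentiableAt ℂ f z :=
  hf.differentiableAt (isOpen_unitDisk.mem_nhds hz)

/-! ### Injective holomorphic maps, their inverses, and subordination -/

/-- An injective holomorphic function has nonvanishing derivative. -/
theorem deriv_ne_zero_of_injOn {f : ℂ → ℂ} {U : Set ℂ} (hU : IsOpen U)
    (hf : DifferentiableOn ℂ f U) (hinj : InjOn f U) {z₀ : ℂ} (hz : z₀ ∈ U) : deriv f z₀ ≠ 0 := by
  intro hd
  have hUz : U ∈ 𝓝 z₀ := hU.mem_nhds hz
  have hfa : AnalyticAt ℂ f z₀ := hf.analyticAt hUz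
  have hFa : AnalyticAt ℂ (fun z => f z - f z₀) z₀ := hfa.sub analyticAt_const
  have hne : ¬ ∀ᶠ z in 𝓝 z₀, f z - f z₀ = 0 := by
    intro h
    have h2 : ∀ᶠ z in 𝓝[≠] z₀, False := by
      have h3 : ∀ᶠ z in 𝓝[≠] z₀, f z - f z₀ = 0 ∧ z ∈ U := (h.and hUz).filter_mono nhdsWithin_le_nhds
      filter_upwards [h3, self_mem_nhdsWithin] with z hz' hzne
      exact hzne (hinj hz'.2 hz (sub_eq_zero.1 hz'.1))
    simpa using h2.exists
  obtain ⟨n, g, hg, hg0, hfg⟩ := hFa.exists_eventuallyEq_pow_smul_nonzero_iff.2 hne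
  have hn0 : n ≠ 0 := by
    rintro rfl
    have := hfg.self_of_nhds
    simp at this
    exact hg0 this.symm
  have hn1 : n ≠ 1 := by
    rintro rfl
    have h1 : deriv (fun z => f z - f z₀) z₀ = deriv (fun z => (z - z₀) ^ 1 • g z) z₀ :=
      Filter.EventuallyEq.deriv_eq hfg
    have h2 : HasDerivAt (fun z => (z - z₀) ^ 1 • g z) (1 * g z₀ + (z₀ - z₀) * deriv g z₀) z₀ := by
      simp only [pow_one, smul_eq_mul]
      exact ((hasDerivAt_id z₀).sub_const z₀).mul hg.differentiableAt.hasDerivAt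
    rw [h2.deriv, deriv_sub_const, hd] at h1
    simp at h1
    exact hg0 h1.symm
  obtain ⟨c, hc⟩ := IsAlgClosed.exists_pow_nat_eq (g z₀) (Nat.pos_of_ne_zero hn0)
  have hc0 : c ≠ 0 := by
    rintro rfl
    rw [zero_pow hn0] at hc
    exact hg0 hc.symm
  -- The base equals 1 at `z₀`, away from the branch cut, so the principal root is analytic there.
  -- Then `f - f z₀` is the `n`-th power of a local coordinate `k`.
  set h : ℂ → ℂ := fun z => (g z / g z₀) ^ (1 / n : ℂ) with hh
  have hha : AnalyticAt ℂ h z₀ :=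
    (hg.div analyticAt_const hg0).cpow analyticAt_const (by simp [hg0])
  have hh0 : h z₀ = 1 := by simp [hh, hg0]
  have hhn : ∀ z, h z ^ n = g z / g z₀ := fun z => by
    have := cpow_nat_inv_pow (g z / g z₀) hn0
    simpa [hh] using this
  set k : ℂ → ℂ := fun z => (z - z₀) * (c * h z) with hk
  have hka : AnalyticAt ℂ k z₀ :=
    (analyticAt_id.sub analyticAt_const).mul (analyticAt_const.mul hha)
  have hkd : HasStrictDerivAt k c z₀ := by
    have h1 := hka.hasStrictDerivAt
    have h2 : HasDerivAt k (1 * (c * h z₀) + (z₀ - z₀) * (c * deriv h z₀)) z₀ :=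
      ((hasDerivAt_id z₀).sub_const z₀).mul (hha.differentiableAt.hasDerivAt.const_mul c)
    rw [h2.deriv] at h1
    simpa [hh0] using h1
  have hk0 : k z₀ = 0 := by simp [hk]
  have hmap := hkd.map_nhds_eq hc0
  rw [hk0] at hmap
  have hgood : ∀ᶠ z in 𝓝 z₀, z ∈ U ∧ f z = f z₀ + k z ^ n := by
    filter_upwards [hUz, hfg] with z h1 h2
    refine ⟨h1, ?_⟩
    rw [hk]
    simp only [mul_pow, hhn, hc]
    rw [smul_eq_mul] at h2
    rw [mul_div_cancel₀ _ hg0, ← h2]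
    ring
  have himg : k '' {z | z ∈ U ∧ f z = f z₀ + k z ^ n} ∈ 𝓝 (0 : ℂ) := by
    rw [← hmap]
    exact image_mem_map hgood
  obtain ⟨ε, hε, hball⟩ := Metric.mem_nhds_iff.1 himg
  -- Since `n ≥ 2`, the values `ε/2` and `ω ε/2` of `k` are distinct but have the same `n`-th power,
  -- which contradicts injectivity.
  obtain ⟨ω, hω⟩ : ∃ ω : ℂ, IsPrimitiveRoot ω n := ⟨_, Complex.isPrimitiveRoot_exp n hn0⟩
  have hω1 : ω ≠ 1 := hω.ne_one (by omega)
  have hωn : ‖ω‖ = 1 := hω.norm'_eq_one hn0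
  have he2 : ‖((ε / 2 : ℝ) : ℂ)‖ < ε := by
    rw [norm_real, Real.norm_of_nonneg (by positivity)]; linarith
  obtain ⟨z₁, ⟨hz1, hf1⟩, hk1⟩ := hball (mem_ball_zero_iff.2 he2)
  obtain ⟨z₂, ⟨hz2, hf2⟩, hk2⟩ := hball
    (mem_ball_zero_iff.2 (show ‖ω * ((ε / 2 : ℝ) : ℂ)‖ < ε by rwa [norm_mul, hωn, one_mul]))
  have h12 : z₁ = z₂ := by
    apply hinj hz1 hz2
    rw [hf1, hf2, hk1, hk2, mul_pow, hω.pow_eq_one, one_mul]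
  rw [← h12, hk1] at hk2
  have hεc : ((ε / 2 : ℝ) : ℂ) ≠ 0 := by
    rw [Ne, ofReal_eq_zero]; positivity
  exact hω1 (by
    have := mul_right_cancel₀ hεc (hk2.symm.trans (one_mul _).symm)
    exact this)

theorem image_mem_nhds_of_injOn {f : ℂ → ℂ} {U V : Set ℂ} (hU : IsOpen U)
    (hf : DifferentiableOn ℂ f U) (hinj : InjOn f U) {z : ℂ} (hz : z ∈ U) (hV : V ∈ 𝓝 z) :
    f '' V ∈ 𝓝 (f z) := by
  have h1 := (hf.analyticAt (hU.mem_nhds hz)).hasStrictDerivAt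
  rw [← h1.map_nhds_eq (deriv_ne_zero_of_injOn hU hf hinj hz)]
  exact image_mem_map hV

theorem hasDerivAt_invFunOn {f : ℂ → ℂ} {U : Set ℂ} (hU : IsOpen U)
    (hf : DifferentiableOn ℂ f U) (hinj : InjOn f U) {z : ℂ} (hz : z ∈ U) :
    HasDerivAt (Function.invFunOn f U) (deriv f z)⁻¹ (f z) := by
  have h1 := (hf.analyticAt (hU.mem_nhds hz)).hasStrictDerivAt
  refine (h1.to_local_left_inverse (deriv_ne_zero_of_injOn hU hf hinj hz) ?_).hasDerivAt
  filter_upwards [hU.mem_nhds hz] with x hx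
  exact hinj.leftInvOn_invFunOn hx

theorem isOpen_image_of_injOn {f : ℂ → ℂ} {U : Set ℂ} (hU : IsOpen U)
    (hf : DifferentiableOn ℂ f U) (hinj : InjOn f U) : IsOpen (f '' U) := by
  rw [isOpen_iff_mem_nhds]
  rintro _ ⟨z, hz, rfl⟩
  exact image_mem_nhds_of_injOn hU hf hinj hz (hU.mem_nhds hz)

theorem IsSchwarz.norm_le {w : ℂ → ℂ} (hw : IsSchwarz w) {z : ℂ} (hz : z ∈ unitDisk) :
    ‖w z‖ ≤ ‖z‖ :=
  Complex.norm_le_norm_of_mapsTo_ball hw.1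
    (fun _ h => ball_subset_closedBall (hw.2.2 _ h)) hw.2.1 (mem_unitDisk.1 hz)

theorem IsSchwarz.norm_deriv_le_one {w : ℂ → ℂ} (hw : IsSchwarz w) : ‖deriv w 0‖ ≤ 1 :=
  Complex.norm_deriv_le_one_of_mapsTo_ball hw.1
    (fun _ h => by rw [hw.2.1]; exact ball_subset_closedBall (hw.2.2 _ h)) one_pos

theorem exists_eq_of_invFunOn {f : ℂ → ℂ} {U : Set ℂ} {v : ℂ} (hv : v ∈ f '' U) :
    Function.invFunOn f U v ∈ U ∧ f (Function.invFunOn f U v) = v :=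
  ⟨Function.invFunOn_mem hv, Function.invFunOn_eq hv⟩

theorem differentiableOn_invFunOn_comp {f g : ℂ → ℂ} {U V : Set ℂ} (hU : IsOpen U)
    (hf : DifferentiableOn ℂ f U) (hinj : InjOn f U) (hg : DifferentiableOn ℂ g V)
    (hgV : ∀ z ∈ V, g z ∈ f '' U) :
    DifferentiableOn ℂ (fun z => Function.invFunOn f U (g z)) V := by
  intro z hz
  obtain ⟨h1, h2⟩ := exists_eq_of_invFunOn (hgV z hz)
  have := hasDerivAt_invFunOn hU hf hinj h1
  rw [h2] at this
  exact this.differentiableAt.comp_differentiableWithinAt z (hg z hz)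

/-- A holomorphic function with the right value at the origin and values in the image of an
injective holomorphic function is subordinate to it. -/
theorem isSchwarz_invFunOn_comp {f g : ℂ → ℂ}
    (hf : DifferentiableOn ℂ f unitDisk) (hinj : InjOn f unitDisk)
    (hg : DifferentiableOn ℂ g unitDisk) (h0 : g 0 = f 0)
    (hgf : ∀ z ∈ unitDisk, g z ∈ f '' unitDisk) :
    IsSchwarz (fun z => Function.invFunOn f unitDisk (g z)) := by
  refine ⟨differentiableOn_invFunOn_comp isOpen_unitDisk hf hinj hg hgf, ?_,
    fun z hz => (exists_eq_of_invFunOn (hgf z hz)).1⟩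
  simp only [h0]
  exact hinj.leftInvOn_invFunOn zero_mem_unitDisk

theorem subordinate_of_injOn {f g : ℂ → ℂ}
    (hf : DifferentiableOn ℂ f unitDisk) (hinj : InjOn f unitDisk)
    (hg : DifferentiableOn ℂ g unitDisk) (h0 : g 0 = f 0)
    (hgf : ∀ z ∈ unitDisk, g z ∈ f '' unitDisk) : Subordinate g f :=
  ⟨_, isSchwarz_invFunOn_comp hf hinj hg h0 hgf,
    fun z hz => (exists_eq_of_invFunOn (hgf z hz)).2.symm⟩

/-! ### First-order conditions and a minimum principle -/

theorem deriv_nonpos_of_le_right {h : ℝ → ℝ} {h' : ℝ} (hd : HasDerivAt h h' 0)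
    (hle : ∀ t ∈ Ioo (0 : ℝ) 1, h t ≤ h 0) : h' ≤ 0 := by
  refine le_of_tendsto
    ((hasDerivWithinAt_iff_tendsto_slope' (by simp)).1 (hd.hasDerivWithinAt (s := Ioi 0))) ?_
  filter_upwards [Ioo_mem_nhdsGT (one_pos : (0 : ℝ) < 1)] with t ht
  rw [slope_def_field, sub_zero]
  exact div_nonpos_of_nonpos_of_nonneg (sub_nonpos.2 (hle t ht)) ht.1.le

/-- First order conditions at a point where the real part is minimal over a disk. -/
theorem mul_deriv_of_re_min {q : ℂ → ℂ} {z₀ : ℂ} (hq : DifferentiableAt ℂ q z₀)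
    (hmin : ∀ z, ‖z‖ ≤ ‖z₀‖ → (q z₀).re ≤ (q z).re) :
    (z₀ * deriv q z₀).im = 0 ∧ (z₀ * deriv q z₀).re ≤ 0 := by
  constructor
  -- Rotations stay on the circle for both signs of `t`, so the derivative vanishes. The contraction
  -- `(1 - t) z₀` used for the second claim is admissible only for `t ≥ 0` and yields a sign.
  · have hc : HasDerivAt (fun t : ℝ => z₀ * exp (t * I)) (z₀ * I) 0 := by
      have h1 : HasDerivAt (fun t : ℝ => (t : ℂ) * I) (1 * I) (0 : ℝ) :=
        (ofRealCLM.hasDerivAt (x := 0)).mul_const I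
      have := (h1.cexp).const_mul z₀
      simpa using this
    have h2 : HasDerivAt (fun t : ℝ => q (z₀ * exp (t * I))) (deriv q z₀ * (z₀ * I)) 0 := by
      have hq' : HasDerivAt q (deriv q z₀) (z₀ * exp (((0 : ℝ) : ℂ) * I)) := by
        simpa using hq.hasDerivAt
      exact hq'.comp (0 : ℝ) hc
    have h3 : HasDerivAt (fun t : ℝ => (q (z₀ * exp (t * I))).re) (deriv q z₀ * (z₀ * I)).re 0 :=
      (reCLM.hasFDerivAt.comp_hasDerivAt (0 : ℝ) h2)
    have h4 : IsLocalMin (fun t : ℝ => (q (z₀ * exp (t * I))).re) 0 := by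
      refine Eventually.of_forall fun t => ?_
      simpa using hmin (z₀ * exp (t * I)) (by simp [norm_exp_ofReal_mul_I])
    have h5 := h4.hasDerivAt_eq_zero h3
    have h6 : (deriv q z₀ * (z₀ * I)).re = -(z₀ * deriv q z₀).im := by
      simp only [mul_re, mul_im, I_re, I_im]; ring
    linarith
  · have hc : HasDerivAt (fun t : ℝ => ((1 - t : ℝ) : ℂ) * z₀) (-z₀) 0 := by
      have h1 : HasDerivAt (fun t : ℝ => ((1 - t : ℝ) : ℂ)) (((-1 : ℝ) : ℂ)) 0 :=
        ((hasDerivAt_id (0 : ℝ)).const_sub 1).ofReal_comp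
      simpa using h1.mul_const z₀
    have h2 : HasDerivAt (fun t : ℝ => q (((1 - t : ℝ) : ℂ) * z₀)) (deriv q z₀ * (-z₀)) 0 := by
      have hq' : HasDerivAt q (deriv q z₀) (((1 - 0 : ℝ) : ℂ) * z₀) := by
        simpa using hq.hasDerivAt
      exact hq'.comp (0 : ℝ) hc
    have h3 : HasDerivAt (fun t : ℝ => (q (((1 - t : ℝ) : ℂ) * z₀)).re)
        (deriv q z₀ * (-z₀)).re 0 :=
      (reCLM.hasFDerivAt.comp_hasDerivAt (0 : ℝ) h2)
    have h4 := deriv_nonpos_of_le_right h3.neg fun t ht => by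
      simpa using hmin (((1 - t : ℝ) : ℂ) * z₀) (by
        rw [norm_mul, norm_real, Real.norm_of_nonneg (by linarith [ht.2])]
        exact mul_le_of_le_one_left (norm_nonneg _) (by linarith [ht.1]))
    have h5 : deriv q z₀ * (-z₀) = -(z₀ * deriv q z₀) := by ring
    rw [h5, neg_re, neg_neg] at h4
    exact h4

/-- A minimum principle: the differential inequality `Re (q + p z q') ≥ 0` with `Re p ≥ 0` forces
`Re q ≥ 0`. -/
theorem re_nonneg_of_re_add_mul_deriv_nonneg {q p : ℂ → ℂ} (hq : DifferentiableOn ℂ q unitDisk)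
    (hp : ∀ z ∈ unitDisk, 0 ≤ (p z).re)
    (h : ∀ z ∈ unitDisk, 0 ≤ (q z + p z * (z * deriv q z)).re) {z : ℂ} (hz : z ∈ unitDisk) :
    0 ≤ (q z).re := by
  have hsub : closedBall (0 : ℂ) ‖z‖ ⊆ unitDisk := fun x hx =>
    mem_unitDisk_of_norm_le (mem_closedBall_zero_iff.1 hx) hz
  obtain ⟨z₀, hz₀, hmin⟩ := (isCompact_closedBall (0 : ℂ) ‖z‖).exists_isMinOn ⟨z, by simp⟩
    (f := fun x => (q x).re) (continuous_re.comp_continuousOn (hq.continuousOn.mono hsub))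
  have hzn : ‖z₀‖ ≤ ‖z‖ := mem_closedBall_zero_iff.1 hz₀
  -- At the minimum `z q'` is a nonpositive real, so the term `p z q'` cannot be what makes the sum
  -- nonnegative.
  obtain ⟨h1, h2⟩ := mul_deriv_of_re_min (hq.differentiableAt_unitDisk (hsub hz₀))
    (fun x hx => hmin (mem_closedBall_zero_iff.2 (hx.trans hzn)))
  have h3 : (q z₀).re ≤ (q z).re := hmin (mem_closedBall_zero_iff.2 le_rfl)
  have h4 := h z₀ (hsub hz₀)
  rw [add_re, mul_re, h1, mul_zero, sub_zero] at h4
  nlinarith [mul_nonneg (hp z₀ (hsub hz₀)) (neg_nonneg.2 h2)]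

/-! ### Convex images and supporting half-planes -/

/-- A closed planar set with interior points all of whose boundary points have a supporting
half-plane is convex. -/
theorem convex_of_forall_frontier_supported {K : Set ℂ} (hK : IsClosed K) {u₀ : ℂ}
    (hu₀ : u₀ ∈ interior K)
    (hs : ∀ w ∈ frontier K, ∃ c : ℂ, c ≠ 0 ∧ ∀ u ∈ K, 0 ≤ (c * (w - u)).re) : Convex ℝ K := by
  intro x hx y hy a b ha hb hab
  by_contra hv
  set v := a • x + b • y with hvdef
  -- A segment from the interior point to `v ∉ K` meets the frontier. The supporting functional at
  -- that point `w` is strictly positive at `u₀` and nonnegative at `v`, yet vanishes at `w`, which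
  -- lies between them.
  obtain ⟨w, hwseg, hwf⟩ : (segment ℝ u₀ v ∩ frontier K).Nonempty := by
    by_contra hne
    rw [Set.not_nonempty_iff_eq_empty] at hne
    have hpc : IsPreconnected (segment ℝ u₀ v) := (convex_segment u₀ v).isPreconnected
    have hsub := hpc.subset_left_of_subset_union isOpen_interior hK.isOpen_compl
      (disjoint_left.2 fun x hx hx' => hx' (interior_subset hx))
      (fun x hx => by
        by_cases hxK : x ∈ K
        · by_cases hxi : x ∈ interior K
          · exact Or.inl hxi
          · exfalso
            have : x ∈ segment ℝ u₀ v ∩ frontier K :=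
              ⟨hx, by rw [hK.frontier_eq]; exact ⟨hxK, hxi⟩⟩
            rw [hne] at this
            exact this
        · exact Or.inr hxK)
      ⟨u₀, left_mem_segment ℝ _ _, hu₀⟩
    exact hv (interior_subset (hsub (right_mem_segment ℝ _ _)))
  obtain ⟨c, hc, hcK⟩ := hs w hwf
  have hwK : w ∈ K := hK.frontier_subset hwf
  obtain ⟨s, t, hs0, ht0, hst, hw⟩ := hwseg
  have hu : 0 < (c * (w - u₀)).re := by
    obtain ⟨ε, hε, hball⟩ := Metric.isOpen_iff.1 isOpen_interior u₀ hu₀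
    have hcn : 0 < ‖c‖ := norm_pos_iff.2 hc
    set δ : ℝ := ε / (2 * ‖c‖) with hδ
    have hδ0 : 0 < δ := by positivity
    have hmem : u₀ + δ * (starRingEnd ℂ) c ∈ K := by
      apply interior_subset (hball _)
      rw [mem_ball, dist_eq_norm, add_sub_cancel_left, norm_mul, norm_real,
        Real.norm_of_nonneg hδ0.le, RCLike.norm_conj, hδ]
      field_simp
      linarith
    have h1 := hcK _ hmem
    have h2 : c * (w - (u₀ + δ * (starRingEnd ℂ) c)) = c * (w - u₀) - (δ * normSq c : ℝ) := by
      push_cast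
      rw [← mul_conj]; ring
    rw [h2, sub_re, ofReal_re] at h1
    have : 0 < δ * normSq c := mul_pos hδ0 (normSq_pos.2 hc)
    linarith
  have hv' : 0 ≤ (c * (w - v)).re := by
    have h1 := mul_nonneg ha (hcK x hx)
    have h2 := mul_nonneg hb (hcK y hy)
    have h3 : c * (w - v) = (a : ℂ) * (c * (w - x)) + (b : ℂ) * (c * (w - y)) := by
      have : (a : ℂ) + b = 1 := by exact_mod_cast hab
      rw [hvdef]
      simp only [real_smul]
      linear_combination c * w * (-this)
    rw [h3, add_re, re_ofReal_mul, re_ofReal_mul]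
    linarith
  have hst' : (s : ℂ) + t = 1 := by exact_mod_cast hst
  have hs1 : 0 < s := by
    rcases hs0.lt_or_eq with h | h
    · exact h
    · exfalso
      apply hv
      rw [← h] at hst hw
      have : t = 1 := by linarith
      rw [this] at hw
      simp at hw
      rw [hw]; exact hwK
  have h5 : (s : ℂ) * (c * (w - u₀)) + (t : ℂ) * (c * (w - v)) = 0 := by
    rw [← hw]
    simp only [real_smul]
    linear_combination c * (s * u₀ + t * v) * hst'
  have h6 := congrArg re h5
  rw [add_re, re_ofReal_mul, re_ofReal_mul, zero_re] at h6
  nlinarith [mul_pos hs1 hu, mul_nonneg ht0 hv']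

/-- First order characterization of convexity, direct part. -/
theorem IsConvexFunction.re_nonneg {φ : ℂ → ℂ} (hφ : IsConvexFunction φ) {x z : ℂ} (hx : ‖x‖ ≤ 1)
    (hz : z ∈ unitDisk) (hz0 : z ≠ 0) : 0 ≤ ((φ z - φ (x * z)) / (z * deriv φ z)).re := by
  obtain ⟨hd, hinj, hconv⟩ := hφ
  set g := Function.invFunOn φ unitDisk with hg
  have hx' : ∀ y ∈ unitDisk, x * y ∈ unitDisk := fun y hy => mul_mem_unitDisk hx hy
  have hφ' := deriv_ne_zero_of_injOn isOpen_unitDisk hd hinj hz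
  set d := φ (x * z) - φ z with hdd
  -- By convexity `y ↦ (1 - t) φ y + t φ (x y)` takes values in the image of `φ`, so the Schwarz
  -- lemma applies to its pullback. Equality holds at `t = 0`, where the bound is then
  -- differentiated.
  have hle : ∀ t ∈ Ioo (0 : ℝ) 1, ‖g (φ z + t * d)‖ ≤ ‖z‖ := by
    intro t ht
    have hG : DifferentiableOn ℂ (fun y => φ y + t * (φ (x * y) - φ y)) unitDisk :=
      hd.add (((hd.comp ((differentiableOn_id).const_mul x) hx').sub hd).const_mul (t : ℂ))
    refine (isSchwarz_invFunOn_comp hd hinj hG (by simp) ?_).norm_le hz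
    intro y hy
    have := hconv (mem_image_of_mem φ hy) (mem_image_of_mem φ (hx' y hy))
      (show 0 ≤ 1 - t by linarith [ht.2]) ht.1.le (by ring)
    convert this using 1
    simp only [real_smul]; push_cast; ring
  have h1 : HasDerivAt (fun t : ℝ => φ z + t * d) d 0 := by
    have h1 : HasDerivAt (fun t : ℝ => (t : ℂ)) 1 (0 : ℝ) := ofRealCLM.hasDerivAt (x := 0)
    simpa using (h1.mul_const d).const_add (φ z)
  have h2 : HasDerivAt (fun t : ℝ => g (φ z + t * d)) ((deriv φ z)⁻¹ * d) 0 := by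
    have hq' : HasDerivAt g (deriv φ z)⁻¹ (φ z + ((0 : ℝ) : ℂ) * d) := by
      simpa using hasDerivAt_invFunOn isOpen_unitDisk hd hinj hz
    exact hq'.comp (0 : ℝ) h1
  have h3 : HasDerivAt (fun t : ℝ => (starRingEnd ℂ z * g (φ z + t * d)).re)
      (starRingEnd ℂ z * ((deriv φ z)⁻¹ * d)).re 0 :=
    reCLM.hasFDerivAt.comp_hasDerivAt (0 : ℝ) (h2.const_mul _)
  have h4 := deriv_nonpos_of_le_right h3 fun t ht => by
    have h5 : g (φ z) = z := hinj.leftInvOn_invFunOn hz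
    simp only [ofReal_zero, zero_mul, add_zero, h5]
    calc _ ≤ ‖starRingEnd ℂ z * g (φ z + t * d)‖ := re_le_norm _
      _ ≤ ‖z‖ * ‖z‖ := by
        rw [norm_mul, RCLike.norm_conj]
        exact mul_le_mul_of_nonneg_left (hle t ht) (norm_nonneg _)
      _ = _ := by
        rw [mul_comm (starRingEnd ℂ z), mul_conj, ofReal_re, normSq_eq_norm_sq, sq]
  have h6 : starRingEnd ℂ z * ((deriv φ z)⁻¹ * d)
      = -((normSq z : ℝ) * ((φ z - φ (x * z)) / (z * deriv φ z))) := by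
    rw [← mul_conj, hdd]; field_simp; ring
  rw [h6, neg_re, re_ofReal_mul] at h4
  have h7 : 0 < normSq z := normSq_pos.2 hz0
  by_contra! hneg
  nlinarith [mul_neg_of_pos_of_neg h7 hneg]

/-- First order characterization of convexity, converse part. -/
theorem convex_image_of_re_nonneg {ψ : ℂ → ℂ} (hd : DifferentiableOn ℂ ψ unitDisk)
    (hinj : InjOn ψ unitDisk)
    (h : ∀ x z : ℂ, ‖x‖ ≤ 1 → z ∈ unitDisk → z ≠ 0 →
      0 ≤ ((ψ z - ψ (x * z)) / (z * deriv ψ z)).re) : Convex ℝ (ψ '' unitDisk) := by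
  have key : ∀ r : ℝ, 0 < r → r < 1 → Convex ℝ (ψ '' closedBall 0 r) := by
    intro r hr0 hr1
    have hsub : closedBall (0 : ℂ) r ⊆ unitDisk := closedBall_subset_ball hr1
    have hK : IsClosed (ψ '' closedBall 0 r) :=
      ((isCompact_closedBall 0 r).image_of_continuousOn (hd.continuousOn.mono hsub)).isClosed
    have hint : ∀ ζ : ℂ, ‖ζ‖ < r → ψ ζ ∈ interior (ψ '' closedBall 0 r) := by
      intro ζ hζ
      rw [mem_interior_iff_mem_nhds]
      exact image_mem_nhds_of_injOn isOpen_unitDisk hd hinj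
        (hsub (mem_closedBall_zero_iff.2 hζ.le)) (mem_of_superset
          (isOpen_ball.mem_nhds (mem_ball_zero_iff.2 hζ)) ball_subset_closedBall)
    refine convex_of_forall_frontier_supported hK (hint 0 (by simpa using hr0)) ?_
    rintro w hw
    rw [hK.frontier_eq] at hw
    obtain ⟨⟨ζ, hζ, rfl⟩, hni⟩ := hw
    have hζr : ‖ζ‖ = r := by
      refine le_antisymm (mem_closedBall_zero_iff.1 hζ) ?_
      by_contra! hlt
      exact hni (hint ζ hlt)
    have hζ0 : ζ ≠ 0 := by rw [← norm_pos_iff, hζr]; exact hr0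
    -- `ζ ψ' ζ` is the outward normal to the image of the circle at `ψ ζ`; the hypothesis with `x =
    -- ξ / ζ` is the supporting inequality.
    refine ⟨(ζ * deriv ψ ζ)⁻¹, inv_ne_zero (mul_ne_zero hζ0
      (deriv_ne_zero_of_injOn isOpen_unitDisk hd hinj (hsub hζ))), ?_⟩
    rintro _ ⟨ξ, hξ, rfl⟩
    have := h (ξ / ζ) ζ (by
      rw [norm_div, hζr]
      exact div_le_one_of_le₀ (mem_closedBall_zero_iff.1 hξ) hr0.le) (hsub hζ) hζ0
    rwa [div_mul_cancel₀ _ hζ0, div_eq_inv_mul] at this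
  rintro _ ⟨a, ha, rfl⟩ _ ⟨b, hb, rfl⟩ s t hs ht hst
  rw [mem_unitDisk] at ha hb
  obtain ⟨r, hr, hr1⟩ := exists_between (max_lt ha hb)
  have hr0 : 0 < r := (norm_nonneg a).trans_lt ((le_max_left _ _).trans_lt hr)
  exact image_mono (closedBall_subset_ball hr1) (key r hr0 hr1
    (mem_image_of_mem ψ (mem_closedBall_zero_iff.2 ((le_max_left _ _).trans hr.le)))
    (mem_image_of_mem ψ (mem_closedBall_zero_iff.2 ((le_max_right _ _).trans hr.le))) hs ht hst)

/-! ### The integral mean and its differential equation -/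

theorem ofReal_mul_mem_unitDisk {t : ℝ} (ht : t ∈ Icc (0 : ℝ) 1) {z : ℂ} (hz : z ∈ unitDisk) :
    (t : ℂ) * z ∈ unitDisk :=
  mul_mem_unitDisk (by rw [norm_real, Real.norm_of_nonneg ht.1]; exact ht.2) hz

theorem continuousOn_comp_ofReal_mul {φ : ℂ → ℂ} (hφ : ContinuousOn φ unitDisk) {z : ℂ}
    (hz : z ∈ unitDisk) : ContinuousOn (fun t : ℝ => φ ((t : ℂ) * z)) (uIcc 0 1) := by
  rw [uIcc_of_le zero_le_one]
  exact hφ.comp (by fun_prop) fun t ht => ofReal_mul_mem_unitDisk ht hz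

theorem integralMean_zero (φ : ℂ → ℂ) : integralMean φ 0 = φ 0 := by simp [integralMean]

/-- The mean is the difference quotient at 0 of a primitive of `φ`; `dslope` fills in the origin,
which makes holomorphy of the mean immediate. -/
theorem integralMean_eqOn_dslope {φ Φ : ℂ → ℂ} (hφ : DifferentiableOn ℂ φ unitDisk)
    (hΦ : ∀ z ∈ unitDisk, HasDerivAt Φ (φ z) z) :
    EqOn (integralMean φ) (dslope Φ 0) unitDisk := by
  intro z hz
  rcases eq_or_ne z 0 with rfl | hz0
  · rw [dslope_same, (hΦ 0 hz).deriv, integralMean_zero]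
  · have h1 : ∫ t in (0 : ℝ)..1, φ ((t : ℂ) * z) * z = Φ (((1 : ℝ) : ℂ) * z) - Φ (((0 : ℝ) : ℂ) * z) := by
      apply intervalIntegral.integral_eq_sub_of_hasDerivAt
        (f := fun t : ℝ => Φ ((t : ℂ) * z))
      · intro t ht
        rw [uIcc_of_le zero_le_one] at ht
        have h2 : HasDerivAt (fun t : ℝ => (t : ℂ) * z) (1 * z) t :=
          (ofRealCLM.hasDerivAt (x := t)).mul_const z
        rw [one_mul] at h2
        exact (hΦ _ (ofReal_mul_mem_unitDisk ht hz)).comp t h2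
      · exact ((continuousOn_comp_ofReal_mul hφ.continuousOn hz).mul
          continuousOn_const).intervalIntegrable
    rw [intervalIntegral.integral_mul_const] at h1
    rw [dslope_of_ne _ hz0, slope_def_field, integralMean, eq_div_iff (by simpa using hz0), sub_zero,
      h1]
    simp

theorem differentiableOn_integralMean {φ : ℂ → ℂ} (hφ : DifferentiableOn ℂ φ unitDisk) :
    DifferentiableOn ℂ (integralMean φ) unitDisk := by
  obtain ⟨Φ, hΦ⟩ := hφ.isExactOn_ball
  refine DifferentiableOn.congr ?_ (integralMean_eqOn_dslope hφ hΦ)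
  exact (differentiableOn_dslope (isOpen_unitDisk.mem_nhds zero_mem_unitDisk)).2
    fun z hz => (hΦ z hz).differentiableAt.differentiableWithinAt

/-- The integral mean `ψ` of `φ` solves the differential equation `ψ + z ψ' = φ`. -/
theorem integralMean_add_mul_deriv {φ : ℂ → ℂ} (hφ : DifferentiableOn ℂ φ unitDisk) {z : ℂ}
    (hz : z ∈ unitDisk) : integralMean φ z + z * deriv (integralMean φ) z = φ z := by
  obtain ⟨Φ, hΦ⟩ := hφ.isExactOn_ball
  have h1 : HasDerivAt (fun y => y * integralMean φ y)
      (1 * integralMean φ z + z * deriv (integralMean φ) z) z :=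
    (hasDerivAt_id z).mul
      ((differentiableOn_integralMean hφ).differentiableAt_unitDisk hz).hasDerivAt
  have h2 : HasDerivAt (fun y => y * integralMean φ y) (φ z) z := by
    refine ((hΦ z hz).sub_const (Φ 0)).congr_of_eventuallyEq ?_
    filter_upwards [isOpen_unitDisk.mem_nhds hz] with y hy
    rw [integralMean_eqOn_dslope hφ hΦ hy]
    simpa using sub_smul_dslope Φ 0 y
  rw [← h1.unique h2, one_mul]

theorem two_mul_deriv_zero_of_add_mul_deriv {u g : ℂ → ℂ} (hu : DifferentiableOn ℂ u unitDisk)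
    (h : ∀ z ∈ unitDisk, u z + z * deriv u z = g z) : 2 * deriv u 0 = deriv g 0 := by
  have h0 := zero_mem_unitDisk
  have hu' := (hu.deriv isOpen_unitDisk).differentiableAt_unitDisk h0
  have h1 : HasDerivAt (fun z => u z + z * deriv u z)
      (deriv u 0 + (1 * deriv u 0 + 0 * deriv (deriv u) 0)) 0 :=
    (hu.differentiableAt_unitDisk h0).hasDerivAt.add ((hasDerivAt_id 0).mul hu'.hasDerivAt)
  have h2 : (fun z => u z + z * deriv u z) =ᶠ[𝓝 0] g := by
    filter_upwards [isOpen_unitDisk.mem_nhds h0] with z hz using h z hz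
  rw [← h2.deriv_eq, h1.deriv]; ring

theorem re_integralMean_pos {φ : ℂ → ℂ} (hφ : DifferentiableOn ℂ φ unitDisk)
    (hre : ∀ z ∈ unitDisk, 0 < (φ z).re) {z : ℂ} (hz : z ∈ unitDisk) :
    0 < (integralMean φ z).re := by
  have hc := continuousOn_comp_ofReal_mul hφ.continuousOn hz
  have h1 : (integralMean φ z).re = ∫ t in (0 : ℝ)..1, (φ ((t : ℂ) * z)).re :=
    (reCLM.intervalIntegral_comp_comm hc.intervalIntegrable).symm
  rw [h1]
  exact intervalIntegral.intervalIntegral_pos_of_pos_on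
    (continuous_re.comp_continuousOn hc).intervalIntegrable
    (fun t ht => hre _ (ofReal_mul_mem_unitDisk (Ioo_subset_Icc_self ht) hz)) one_pos

/-- A holomorphic function on the disk with nonnegative real part, positive at the origin, has
positive real part. -/
theorem re_pos_of_re_nonneg {p : ℂ → ℂ} (hp : DifferentiableOn ℂ p unitDisk)
    (h0 : 0 < (p 0).re) (h : ∀ z ∈ unitDisk, 0 ≤ (p z).re) {z : ℂ} (hz : z ∈ unitDisk) :
    0 < (p z).re := by
  by_contra! hle
  have hd : DifferentiableOn ℂ (fun y => exp (-p y)) unitDisk := hp.neg.cexp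
  -- If `Re p z ≤ 0`, then `‖exp (-p)‖`, which is at most one everywhere, is maximal at `z`, hence
  -- constant; but it is less than one at 0.
  have hmax : IsMaxOn (norm ∘ fun y => exp (-p y)) unitDisk z := by
    intro y hy
    simp only [mem_ofPred_eq, Function.comp_apply, norm_exp, neg_re]
    exact Real.exp_le_exp.2 (by linarith [h y hy])
  have := Complex.norm_eqOn_of_isPreconnected_of_isMaxOn (convex_ball (0 : ℂ) 1).isPreconnected
    isOpen_unitDisk hd hz hmax zero_mem_unitDisk
  simp only [Function.comp_apply, Function.const_apply, norm_exp, neg_re, Real.exp_eq_exp] at this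
  linarith

/-! ### Convexity of the integral mean -/

theorem IsConvexFunction.deriv_ne_zero {φ : ℂ → ℂ} (hφ : IsConvexFunction φ) {z : ℂ}
    (hz : z ∈ unitDisk) : deriv φ z ≠ 0 :=
  deriv_ne_zero_of_injOn isOpen_unitDisk hφ.1 hφ.2.1 hz

/-- Because `y ψ' y = φ y - ψ y`, the quotient is the average over `t` of `(φ y - φ (t y)) / (y φ'
y)`. At the origin this formula degenerates, and the quotient is `1/2`. -/
theorem IsConvexFunction.re_deriv_integralMean_div_pos {φ : ℂ → ℂ} (hφ : IsConvexFunction φ)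
    {z : ℂ} (hz : z ∈ unitDisk) : 0 < (deriv (integralMean φ) z / deriv φ z).re := by
  have hd := differentiableOn_integralMean hφ.1
  have hode := fun z (hz : z ∈ unitDisk) => integralMean_add_mul_deriv hφ.1 hz
  have h0 : 0 < (deriv (integralMean φ) 0 / deriv φ 0).re := by
    have h1 := two_mul_deriv_zero_of_add_mul_deriv hd hode
    have h2 := hφ.deriv_ne_zero zero_mem_unitDisk
    have h3 : deriv (integralMean φ) 0 / deriv φ 0 = ((1 / 2 : ℝ) : ℂ) := by
      rw [div_eq_iff h2, ← h1]; push_cast; ring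
    rw [h3, ofReal_re]; norm_num
  refine re_pos_of_re_nonneg ((hd.deriv isOpen_unitDisk).div (hφ.1.deriv isOpen_unitDisk)
    fun y hy => hφ.deriv_ne_zero hy) h0 (fun y hy => ?_) hz
  rcases eq_or_ne y 0 with rfl | hy0
  · exact h0.le
  have hc := continuousOn_comp_ofReal_mul hφ.1.continuousOn hy
  have hne := hφ.deriv_ne_zero hy
  have h1 : deriv (integralMean φ) y / deriv φ y
      = ∫ t in (0 : ℝ)..1, (φ y - φ ((t : ℂ) * y)) / (y * deriv φ y) := by
    rw [intervalIntegral.integral_div, intervalIntegral.integral_sub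
      intervalIntegrable_const hc.intervalIntegrable]
    have h2 := hode y hy
    have h3 : ∫ t in (0 : ℝ)..1, φ ((t : ℂ) * y) = integralMean φ y := rfl
    rw [h3, intervalIntegral.integral_const, ← h2]
    field_simp
    simp
  have hc2 : ContinuousOn (fun t : ℝ => (φ y - φ ((t : ℂ) * y)) / (y * deriv φ y)) (uIcc 0 1) :=
    (continuousOn_const.sub hc).div_const _
  have h4 : (deriv (integralMean φ) y / deriv φ y).re
      = ∫ t in (0 : ℝ)..1, ((φ y - φ ((t : ℂ) * y)) / (y * deriv φ y)).re := by
    rw [h1]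
    exact (reCLM.intervalIntegral_comp_comm hc2.intervalIntegrable).symm
  rw [Pi.div_apply, h4]
  refine intervalIntegral.integral_nonneg zero_le_one fun t ht => ?_
  exact hφ.re_nonneg (by rw [norm_real, Real.norm_of_nonneg ht.1]; exact ht.2) hy hy0

/-- A holomorphic function is injective if its derivative relative to a convex function has
positive real part. -/
theorem IsConvexFunction.injOn_of_re_deriv_div_pos {φ ψ : ℂ → ℂ} (hφ : IsConvexFunction φ)
    (hψ : DifferentiableOn ℂ ψ unitDisk) (h : ∀ z ∈ unitDisk, 0 < (deriv ψ z / deriv φ z).re) :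
    InjOn ψ unitDisk := by
  intro a ha b hb hab
  by_contra hne
  have hφab : φ b - φ a ≠ 0 := sub_ne_zero.2 fun h => hne (hφ.2.1 ha hb h.symm)
  set g := Function.invFunOn φ unitDisk with hg
  set d := φ b - φ a with hd
  have hmem : ∀ t ∈ Icc (0 : ℝ) 1, φ a + t * d ∈ φ '' unitDisk := fun t ht => by
    have := hφ.2.2 (mem_image_of_mem φ ha) (mem_image_of_mem φ hb)
      (show 0 ≤ 1 - t by linarith [ht.2]) ht.1 (by ring)
    convert this using 1
    simp only [real_smul, hd]; push_cast; ring
  -- Along the segment from `φ a` to `φ b`, `Re (ψ ∘ φ⁻¹ / d)` has derivative `Re (ψ'/φ') > 0`;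
  -- equal endpoint values would contradict Rolle's theorem.
  have hder : ∀ t ∈ Icc (0 : ℝ) 1, HasDerivAt (fun t : ℝ => (ψ (g (φ a + t * d)) / d).re)
      (deriv ψ (g (φ a + t * d)) / deriv φ (g (φ a + t * d))).re t := by
    intro t ht
    obtain ⟨h1, h2⟩ := exists_eq_of_invFunOn (hmem t ht)
    have h3 : HasDerivAt (fun t : ℝ => φ a + t * d) d t := by
      have h1 : HasDerivAt (fun t : ℝ => (t : ℂ)) 1 t := ofRealCLM.hasDerivAt (x := t)
      simpa using (h1.mul_const d).const_add (φ a)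
    have h4 := hasDerivAt_invFunOn isOpen_unitDisk hφ.1 hφ.2.1 h1
    rw [h2] at h4
    have h5 := (hψ.differentiableAt_unitDisk h1).hasDerivAt.comp t (h4.comp t h3)
    have h6 : deriv ψ (g (φ a + t * d)) / deriv φ (g (φ a + t * d))
        = deriv ψ (g (φ a + t * d)) * ((deriv φ (g (φ a + t * d)))⁻¹ * d) / d := by
      field_simp
    rw [h6]
    exact reCLM.hasFDerivAt.comp_hasDerivAt t (h5.div_const d)
  obtain ⟨c, hc, hc'⟩ := exists_hasDerivAt_eq_zero (one_pos : (0 : ℝ) < 1)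
    (fun t ht => (hder t ht).continuousAt.continuousWithinAt)
    (by
      have h1 : g (φ a) = a := hφ.2.1.leftInvOn_invFunOn ha
      have h2 : g (φ b) = b := hφ.2.1.leftInvOn_invFunOn hb
      simp [hd, h1, h2, hab])
    (fun t ht => hder t (Ioo_subset_Icc_self ht))
  have := h _ (exists_eq_of_invFunOn (hmem c (Ioo_subset_Icc_self hc))).1
  exact this.ne' hc'

/-- The integral mean of a convex function is a convex function. -/
theorem IsConvexFunction.integralMean {φ : ℂ → ℂ} (hφ : IsConvexFunction φ) :
    IsConvexFunction (integralMean φ) := by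
  set ψ := _root_.integralMean φ with hψ
  have hd : DifferentiableOn ℂ ψ unitDisk := differentiableOn_integralMean hφ.1
  have hode : ∀ z ∈ unitDisk, ψ z + z * deriv ψ z = φ z :=
    fun z hz => integralMean_add_mul_deriv hφ.1 hz
  have hp : ∀ z ∈ unitDisk, 0 < (deriv ψ z / deriv φ z).re :=
    fun z hz => hφ.re_deriv_integralMean_div_pos hz
  have hinj := hφ.injOn_of_re_deriv_div_pos hd hp
  have hψ' : ∀ z ∈ unitDisk, deriv ψ z ≠ 0 :=
    fun z hz => deriv_ne_zero_of_injOn isOpen_unitDisk hd hinj hz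
  refine ⟨hd, hinj, convex_image_of_re_nonneg hd hinj fun x z hx hz hz0 => ?_⟩
  have hx' : ∀ y ∈ unitDisk, x * y ∈ unitDisk := fun y hy => mul_mem_unitDisk hx hy
  set N : ℂ → ℂ := fun y => ψ y - ψ (x * y) with hN
  have hNd : ∀ y ∈ unitDisk, HasDerivAt N (deriv ψ y - x * deriv ψ (x * y)) y := by
    intro y hy
    have h1 : HasDerivAt (fun y => x * y) x y := by simpa using (hasDerivAt_id y).const_mul x
    have h2 := (hd.differentiableAt_unitDisk (hx' y hy)).hasDerivAt.comp y h1
    rw [mul_comm x]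
    exact (hd.differentiableAt_unitDisk hy).hasDerivAt.sub h2
  have hN0 : N 0 = 0 := by simp [hN]
  -- `m / ψ'` is the quotient `(ψ y - ψ (x y)) / (y ψ' y)`, made holomorphic at the origin so that
  -- the minimum principle applies on the whole disk.
  set m := dslope N 0 with hm
  have hmd : DifferentiableOn ℂ m unitDisk :=
    (differentiableOn_dslope (isOpen_unitDisk.mem_nhds zero_mem_unitDisk)).2
      fun y hy => (hNd y hy).differentiableAt.differentiableWithinAt
  have hmN : ∀ y, y * m y = N y := fun y => by
    simpa [hN0] using sub_smul_dslope N 0 y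
  have hqd : DifferentiableOn ℂ (fun y => m y / deriv ψ y) unitDisk :=
    hmd.div (hd.deriv isOpen_unitDisk) hψ'
  have hq := re_nonneg_of_re_add_mul_deriv_nonneg hqd (fun y hy => (hp y hy).le) (fun y hy => ?_) hz
  · have h1 : m z / deriv ψ z = (ψ z - ψ (x * z)) / (z * deriv ψ z) := by
      rw [← mul_div_mul_left _ _ hz0, hmN z]
    rwa [h1] at hq
  rcases eq_or_ne y 0 with rfl | hy0
  · have h1 : m 0 = deriv ψ 0 * (1 - x) := by
      rw [hm, dslope_same, (hNd 0 zero_mem_unitDisk).deriv, mul_zero]; ring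
    simp only [zero_mul, mul_zero, add_zero, h1]
    rw [mul_div_cancel_left₀ _ (hψ' 0 zero_mem_unitDisk), sub_re, one_re, sub_nonneg]
    exact (re_le_norm x).trans hx
  · have h2 := hφ.re_nonneg hx hy hy0
    convert h2 using 2
    have hψy := hψ' y hy
    have hφy := hφ.deriv_ne_zero hy
    have hqy := (hqd.differentiableAt_unitDisk hy).hasDerivAt
    set q : ℂ → ℂ := fun y => m y / deriv ψ y with hqdef
    -- Differentiate the identity `y * N y = q y * (y * (φ y - ψ y))`.
    have hid : (fun y => y * N y) =ᶠ[𝓝 y] fun y => q y * (y * (φ y - ψ y)) := by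
      filter_upwards [isOpen_unitDisk.mem_nhds hy] with v hv
      rw [← hode v hv, ← hmN v, hqdef]
      field_simp [hψ' v hv]
      ring
    have hl : HasDerivAt (fun y => y * N y) (1 * N y + y * (deriv ψ y - x * deriv ψ (x * y))) y :=
      (hasDerivAt_id y).mul (hNd y hy)
    have hr : HasDerivAt (fun y => q y * (y * (φ y - ψ y)))
        (deriv q y * (y * (φ y - ψ y)) + q y * (1 * (φ y - ψ y) + y * (deriv φ y - deriv ψ y))) y :=
      hqy.mul ((hasDerivAt_id y).mul ((hφ.1.differentiableAt_unitDisk hy).hasDerivAt.sub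
        (hd.differentiableAt_unitDisk hy).hasDerivAt))
    have heq := (hl.congr_of_eventuallyEq hid.symm).unique hr
    have h3 := hode y hy
    have h4 := hode (x * y) (hx' y hy)
    rw [eq_div_iff (mul_ne_zero hy0 hφy)]
    rw [← h4]
    have h5 : deriv ψ y / deriv φ y * deriv φ y = deriv ψ y := div_mul_cancel₀ _ hφy
    linear_combination (-1 : ℂ) * heq + y ^ 2 * deriv q y * h5 +
      (m y / deriv ψ y + 1 + y * deriv q y) * h3

/-! ### The principal square root -/

theorem cpow_half_sq (a : ℂ) : (a ^ (1 / 2 : ℂ)) ^ 2 = a := by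
  simp

theorem re_cpow_half_pos {a : ℂ} (ha : 0 < a.re) : 0 < (a ^ (1 / 2 : ℂ)).re := by
  have ha0 : a ≠ 0 := by rintro rfl; simp at ha
  rw [cpow_def_of_ne_zero ha0, exp_re]
  have h1 : (log a * (1 / 2 : ℂ)).im = arg a / 2 := by
    rw [mul_comm, show (1 / 2 : ℂ) = ((1 / 2 : ℝ) : ℂ) by push_cast; rfl, im_ofReal_mul, log_im]
    ring
  rw [h1]
  have h2 := neg_pi_lt_arg a
  have h3 := arg_le_pi a
  have h4 := abs_arg_lt_pi_div_two_iff.2 (Or.inl ha)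
  rw [abs_lt] at h4
  exact mul_pos (Real.exp_pos _) (Real.cos_pos_of_mem_Ioo ⟨by linarith [Real.pi_pos],
    by linarith [Real.pi_pos]⟩)

theorem eq_cpow_half_of_sq_eq {a b : ℂ} (hb : 0 < b.re) (ha : 0 < a.re) (h : b ^ 2 = a) :
    b = a ^ (1 / 2 : ℂ) := by
  rcases sq_eq_sq_iff_eq_or_eq_neg.1 (h.trans (cpow_half_sq a).symm) with h | h
  · exact h
  · have := congrArg re h
    rw [neg_re] at this
    linarith [re_cpow_half_pos ha]

theorem isCaratheodory_integralMean {φ : ℂ → ℂ} (hφ : DifferentiableOn ℂ φ unitDisk)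
    (h0 : φ 0 = 1) (hre : ∀ z ∈ unitDisk, 0 < (φ z).re) : IsCaratheodory (integralMean φ) :=
  ⟨differentiableOn_integralMean hφ, by rw [integralMean_zero, h0],
    fun _ hz => re_integralMean_pos hφ hre hz⟩

theorem isCaratheodory_sqrtMean {φ : ℂ → ℂ} (hφ : DifferentiableOn ℂ φ unitDisk)
    (h0 : φ 0 = 1) (hre : ∀ z ∈ unitDisk, 0 < (φ z).re) : IsCaratheodory (sqrtMean φ) :=
  ⟨(differentiableOn_integralMean hφ).cpow (differentiableOn_const _)
      fun _ hz => Or.inl (re_integralMean_pos hφ hre hz),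
    by simp [sqrtMean, integralMean_zero, h0],
    fun _ hz => re_cpow_half_pos (re_integralMean_pos hφ hre hz)⟩

theorem IsConvexFunction.injOn_sqrtMean {φ : ℂ → ℂ} (hφ : IsConvexFunction φ) :
    InjOn (sqrtMean φ) unitDisk := fun a ha b hb hab => by
  refine hφ.integralMean.2.1 ha hb ?_
  rw [← cpow_half_sq (_root_.integralMean φ a), ← cpow_half_sq (_root_.integralMean φ b)]
  exact congrArg (· ^ 2) hab

/-! ### Subordination to the integral mean -/

/-- Strictness comes from openness: for `‖ω‖ < ‖ζ‖`, `φ ω` can be moved by a small positive multiple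
of `ζ φ' ζ` within the image of the disk of radius `‖ζ‖`, so the weak inequality has room to spare.
-/
theorem IsConvexFunction.re_pos_of_norm_lt {φ : ℂ → ℂ} (hφ : IsConvexFunction φ) {ζ ω : ℂ}
    (hζ : ζ ∈ unitDisk) (h : ‖ω‖ < ‖ζ‖) : 0 < ((φ ζ - φ ω) / (ζ * deriv φ ζ)).re := by
  have hζ0 : ζ ≠ 0 := norm_pos_iff.1 ((norm_nonneg ω).trans_lt h)
  set c := ζ * deriv φ ζ with hc
  have hc0 : c ≠ 0 := mul_ne_zero hζ0 (hφ.deriv_ne_zero hζ)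
  have hω : ω ∈ unitDisk := mem_unitDisk_of_norm_le h.le hζ
  have himg := image_mem_nhds_of_injOn isOpen_unitDisk hφ.1 hφ.2.1 hω
    (isOpen_ball.mem_nhds (mem_ball_zero_iff.2 h))
  obtain ⟨ε, hε, hball⟩ := Metric.mem_nhds_iff.1 himg
  have hcn : 0 < ‖c‖ := norm_pos_iff.2 hc0
  set δ : ℝ := ε / (2 * ‖c‖) with hδ
  have hδ0 : 0 < δ := by positivity
  obtain ⟨ω', hω', heq⟩ := hball (show φ ω + δ * c ∈ ball (φ ω) ε by
    rw [mem_ball, dist_eq_norm, add_sub_cancel_left, norm_mul, norm_real,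
      Real.norm_of_nonneg hδ0.le, hδ]
    field_simp
    linarith)
  have h1 := hφ.re_nonneg (x := ω' / ζ) (by
    rw [norm_div]
    exact div_le_one_of_le₀ (mem_ball_zero_iff.1 hω').le (norm_nonneg _)) hζ hζ0
  rw [div_mul_cancel₀ _ hζ0, heq, ← hc] at h1
  have h2 : (φ ζ - (φ ω + δ * c)) / c = (φ ζ - φ ω) / c - (δ : ℝ) := by
    field_simp; ring
  rw [h2, sub_re, ofReal_re] at h1
  linarith

/-- At a point where the modulus of `f z / z` is maximal over a circle, `z f' / f` is real and at
least one. -/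
theorem exists_mul_deriv_eq_of_norm_lt {f : ℂ → ℂ} {R : ℝ} (hf : DifferentiableOn ℂ f (ball 0 R))
    (h0 : f 0 = 0) {z : ℂ} (hzR : ‖z‖ < R) (hz : ‖z‖ < ‖f z‖) :
    ∃ (z₀ : ℂ) (k : ℝ), ‖z₀‖ = ‖z‖ ∧ ‖z₀‖ < ‖f z₀‖ ∧ 0 ≤ k ∧
      z₀ * deriv f z₀ = (1 + k) * f z₀ := by
  have hz0 : z ≠ 0 := by rintro rfl; simp [h0] at hz
  have hr0 : 0 < ‖z‖ := norm_pos_iff.2 hz0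
  set v := dslope f 0 with hv
  have hvd : DifferentiableOn ℂ v (ball 0 R) :=
    (differentiableOn_dslope (isOpen_ball.mem_nhds (mem_ball_self (hr0.trans hzR)))).2 hf
  have hvf : ∀ y, y * v y = f y := fun y => by simpa [h0] using sub_smul_dslope f 0 y
  have hsub : closedBall (0 : ℂ) ‖z‖ ⊆ ball 0 R := closedBall_subset_ball hzR
  obtain ⟨z₀, hz₀, hmax⟩ := Complex.exists_mem_frontier_isMaxOn_norm (f := v)
    (U := ball (0 : ℂ) ‖z‖) isBounded_ball ⟨0, mem_ball_self hr0⟩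
    ((hvd.mono (by rwa [closure_ball _ hr0.ne'])).diffContOnCl)
  rw [frontier_ball _ hr0.ne', mem_sphere_zero_iff_norm] at hz₀
  rw [closure_ball _ hr0.ne'] at hmax
  have hz₀R : z₀ ∈ ball (0 : ℂ) R := mem_ball_zero_iff.2 (hz₀.trans_lt hzR)
  have hv1 : 1 < ‖v z₀‖ := by
    have h1 : ‖v z‖ ≤ ‖v z₀‖ := hmax (mem_closedBall_zero_iff.2 le_rfl)
    rw [← hvf z, norm_mul] at hz
    refine lt_of_lt_of_le ?_ h1
    by_contra! hle
    nlinarith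
  have hvdiff : DifferentiableAt ℂ v z₀ := hvd.differentiableAt (isOpen_ball.mem_nhds hz₀R)
  have hq : HasDerivAt (fun y => -starRingEnd ℂ (v z₀) * v y)
      (-starRingEnd ℂ (v z₀) * deriv v z₀) z₀ := hvdiff.hasDerivAt.const_mul _
  -- Multiplying by `-conj (v z₀)` turns maximal modulus of `v = f/z` at `z₀` into minimal real
  -- part.
  obtain ⟨him, hre⟩ := mul_deriv_of_re_min hq.differentiableAt fun y hy => by
    have h1 : ‖v y‖ ≤ ‖v z₀‖ := hmax (mem_closedBall_zero_iff.2 (hy.trans hz₀.le))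
    have h2 : (starRingEnd ℂ (v z₀) * v y).re ≤ ‖v z₀‖ * ‖v z₀‖ := by
      refine (re_le_norm _).trans ?_
      rw [norm_mul, RCLike.norm_conj]
      exact mul_le_mul_of_nonneg_left h1 (norm_nonneg _)
    have h3 : (starRingEnd ℂ (v z₀) * v z₀).re = ‖v z₀‖ * ‖v z₀‖ := by
      rw [mul_comm, mul_conj, ofReal_re, normSq_eq_norm_sq, sq]
    simp only [neg_mul, neg_re]
    linarith
  rw [hq.deriv] at him hre
  have hv0 : v z₀ ≠ 0 := norm_pos_iff.1 (one_pos.trans hv1)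
  have hns : 0 < normSq (v z₀) := normSq_pos.2 hv0
  set κ : ℝ := -(z₀ * (-starRingEnd ℂ (v z₀) * deriv v z₀)).re with hκ
  have hκ' : z₀ * (starRingEnd ℂ (v z₀) * deriv v z₀) = κ := by
    apply Complex.ext
    · rw [hκ, ofReal_re, ← neg_re]; congr 1; ring
    · rw [ofReal_im, ← neg_eq_zero, ← neg_im, ← him]; congr 1; ring
  refine ⟨z₀, κ / normSq (v z₀), hz₀, ?_, div_nonneg (by linarith) hns.le, ?_⟩
  · rw [← hvf z₀, norm_mul, hz₀]
    exact lt_mul_of_one_lt_right hr0 hv1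
  · have h1 : HasDerivAt f (1 * v z₀ + z₀ * deriv v z₀) z₀ := by
      have : f = fun y => y * v y := funext fun y => (hvf y).symm
      rw [this]
      exact (hasDerivAt_id z₀).mul hvdiff.hasDerivAt
    rw [h1.deriv, ← hvf z₀]
    have h2 : (normSq (v z₀) : ℂ) ≠ 0 := by exact_mod_cast hns.ne'
    have h3 : z₀ * deriv v z₀ = ((κ / normSq (v z₀) : ℝ) : ℂ) * v z₀ := by
      push_cast
      rw [div_mul_eq_mul_div, eq_div_iff h2, ← hκ', ← mul_conj]
      ring
    linear_combination z₀ * h3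

/-- Otherwise Jack's lemma gives `z₀ f' z₀ = (1 + k) f z₀` with `‖f z₀‖ > ‖z₀‖` for `f = ψ⁻¹ ∘ u`.
With `ζ = f z₀` the two equations give `φ (w z₀) = φ ζ + k ζ ψ' ζ`, contradicting the strict
inequality since `‖w z₀‖ ≤ ‖z₀‖ < ‖ζ‖`. -/
theorem norm_invFunOn_integralMean_le {φ u w : ℂ → ℂ} (hφ : IsConvexFunction φ)
    (hu : DifferentiableOn ℂ u unitDisk) (hw : IsSchwarz w)
    (hode : ∀ z ∈ unitDisk, u z + z * deriv u z = φ (w z)) {R : ℝ} (hR : R ≤ 1)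
    (hmaps : ∀ z ∈ ball (0 : ℂ) R, u z ∈ integralMean φ '' unitDisk) {z : ℂ}
    (hz : z ∈ ball (0 : ℂ) R) : ‖Function.invFunOn (integralMean φ) unitDisk (u z)‖ ≤ ‖z‖ := by
  obtain ⟨hψ, hψinj, -⟩ := hφ.integralMean
  set ψ := integralMean φ with hψdef
  have hsub : ball (0 : ℂ) R ⊆ unitDisk := ball_subset_ball hR
  set f : ℂ → ℂ := fun z => Function.invFunOn ψ unitDisk (u z) with hf
  have hfd : DifferentiableOn ℂ f (ball 0 R) :=
    differentiableOn_invFunOn_comp isOpen_unitDisk hψ hψinj (hu.mono hsub) hmaps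
  have hf0 : f 0 = 0 := by
    have h1 := hode 0 zero_mem_unitDisk
    rw [zero_mul, add_zero, hw.2.1, ← integralMean_zero φ] at h1
    simp only [hf, h1]
    exact hψinj.leftInvOn_invFunOn zero_mem_unitDisk
  by_contra! hlt
  obtain ⟨z₀, k, hz₀, hfz₀, hk, hder⟩ :=
    exists_mul_deriv_eq_of_norm_lt hfd hf0 (mem_ball_zero_iff.1 hz) hlt
  have hz₀R : z₀ ∈ ball (0 : ℂ) R := mem_ball_zero_iff.2 (hz₀.trans_lt (mem_ball_zero_iff.1 hz))
  have hz₀D := hsub hz₀R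
  obtain ⟨hζ, hψζ⟩ := exists_eq_of_invFunOn (hmaps z₀ hz₀R)
  change f z₀ ∈ unitDisk at hζ
  change ψ (f z₀) = u z₀ at hψζ
  have hu' : deriv u z₀ = deriv ψ (f z₀) * deriv f z₀ := by
    have h1 : u =ᶠ[𝓝 z₀] ψ ∘ f := by
      filter_upwards [isOpen_ball.mem_nhds hz₀R] with y hy
      exact (exists_eq_of_invFunOn (hmaps y hy)).2.symm
    rw [h1.deriv_eq]
    exact deriv_comp _ (hψ.differentiableAt_unitDisk hζ)
      (hfd.differentiableAt (isOpen_ball.mem_nhds hz₀R))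
  have h1 := hode z₀ hz₀D
  have h2 := integralMean_add_mul_deriv hφ.1 hζ
  rw [← hψdef] at h2
  have hlt : ‖w z₀‖ < ‖f z₀‖ := (hw.norm_le hz₀D).trans_lt hfz₀
  have h3 := hφ.re_pos_of_norm_lt hζ hlt
  have hφζ := hφ.deriv_ne_zero hζ
  have hζ0 : f z₀ ≠ 0 := norm_pos_iff.1 ((norm_nonneg _).trans_lt hlt)
  have h4 : (φ (f z₀) - φ (w z₀)) / (f z₀ * deriv φ (f z₀))
      = -((k : ℂ) * (deriv ψ (f z₀) / deriv φ (f z₀))) := by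
    rw [div_eq_iff (mul_ne_zero hζ0 hφζ), ← h1, ← h2, hu', hψζ]
    have h5 : deriv ψ (f z₀) / deriv φ (f z₀) * deriv φ (f z₀) = deriv ψ (f z₀) :=
      div_mul_cancel₀ _ hφζ
    linear_combination (-deriv ψ (f z₀)) * hder + k * f z₀ * h5
  rw [h4, neg_re, re_ofReal_mul] at h3
  have h6 := mul_nonneg hk (hφ.re_deriv_integralMean_div_pos hζ).le
  rw [← hψdef] at h6
  linarith

/-- If `u + z u'` is subordinate to a convex function `φ`, then `u` is subordinate to the integral
mean of `φ`. -/
theorem IsConvexFunction.subordinate_integralMean {φ u w : ℂ → ℂ} (hφ : IsConvexFunction φ)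
    (hu : DifferentiableOn ℂ u unitDisk) (hw : IsSchwarz w)
    (hode : ∀ z ∈ unitDisk, u z + z * deriv u z = φ (w z)) :
    Subordinate u (_root_.integralMean φ) := by
  obtain ⟨hψ, hψinj, -⟩ := hφ.integralMean
  set ψ := _root_.integralMean φ with hψdef
  have hu0 : u 0 = ψ 0 := by
    have h1 := hode 0 zero_mem_unitDisk
    rwa [zero_mul, add_zero, hw.2.1, ← integralMean_zero φ] at h1
  refine subordinate_of_injOn hψ hψinj hu hu0 ?_
  -- Continuity method: `ψ⁻¹ ∘ u` is available only where `u` stays in the image of `ψ`. On the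
  -- largest such disk the Schwarz bound confines `u` to a compact part of this open image, so a
  -- radius below one could be enlarged.
  set S : Set ℝ := {R | R ≤ 1 ∧ ∀ z ∈ ball (0 : ℂ) R, u z ∈ ψ '' unitDisk} with hS
  have h0S : (0 : ℝ) ∈ S := ⟨zero_le_one, by simp⟩
  have hbdd : BddAbove S := ⟨1, fun R hR => hR.1⟩
  set R := sSup S with hRdef
  have hR0 : 0 ≤ R := le_csSup hbdd h0S
  have hR1 : R ≤ 1 := csSup_le ⟨0, h0S⟩ fun R hR => hR.1
  have hmaps : ∀ z ∈ ball (0 : ℂ) R, u z ∈ ψ '' unitDisk := by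
    intro z hz
    obtain ⟨R', hR', hlt⟩ := exists_lt_of_lt_csSup ⟨0, h0S⟩ (mem_ball_zero_iff.1 hz)
    exact hR'.2 z (mem_ball_zero_iff.2 hlt)
  rcases hR1.lt_or_eq with hlt | heq
  · exfalso
    have hsub : closedBall (0 : ℂ) R ⊆ unitDisk := closedBall_subset_ball hlt
    have hclosed : ∀ z ∈ closedBall (0 : ℂ) R, u z ∈ ψ '' unitDisk := by
      rcases hR0.eq_or_lt with h0 | hpos
      · intro z hz
        rw [← h0, closedBall_zero, mem_singleton_iff] at hz
        rw [hz, hu0]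
        exact mem_image_of_mem ψ zero_mem_unitDisk
      · have hK : IsClosed (ψ '' closedBall 0 R) :=
          ((isCompact_closedBall 0 R).image_of_continuousOn (hψ.continuousOn.mono hsub)).isClosed
        have hm : MapsTo u (ball 0 R) (ψ '' closedBall 0 R) := fun z hz => by
          refine ⟨_, mem_closedBall_zero_iff.2 ?_, (exists_eq_of_invFunOn (hmaps z hz)).2⟩
          exact (norm_invFunOn_integralMean_le hφ hu hw hode hR1 hmaps hz).trans
            (mem_ball_zero_iff.1 hz).le
        have hcl := hm.closure_of_continuousOn (by
          rw [closure_ball _ hpos.ne']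
          exact hu.continuousOn.mono hsub)
        rw [closure_ball _ hpos.ne', hK.closure_eq] at hcl
        exact fun z hz => image_mono hsub (hcl hz)
    have hO : IsOpen (unitDisk ∩ u ⁻¹' (ψ '' unitDisk)) :=
      hu.continuousOn.isOpen_inter_preimage isOpen_unitDisk
        (isOpen_image_of_injOn isOpen_unitDisk hψ hψinj)
    obtain ⟨δ, hδ, hth⟩ := (isCompact_closedBall (0 : ℂ) R).exists_thickening_subset_open hO
      fun z hz => ⟨hsub hz, hclosed z hz⟩
    rw [thickening_closedBall hδ hR0] at hth
    have hmem : min (δ + R) 1 ∈ S :=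
      ⟨min_le_right _ _, fun z hz => (hth (ball_subset_ball (min_le_left _ _) hz)).2⟩
    exact absurd (le_csSup hbdd hmem) (not_le.2 (lt_min (by linarith) hlt))
  · rw [heq] at hmaps
    exact hmaps

/-! ### Power series, Parseval and Rogosinski -/

theorem hasFPowerSeriesOnBall_of_hasSum {a : ℕ → ℂ} {F : ℂ → ℂ}
    (h : ∀ z ∈ unitDisk, HasSum (fun n => a n * z ^ n) (F z)) :
    HasFPowerSeriesOnBall F (FormalMultilinearSeries.ofScalars ℂ a) 0 1 := by
  refine ⟨?_, one_pos, fun {y} hy => ?_⟩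
  · refine ENNReal.le_of_forall_nnreal_lt fun r hr => ?_
    have hr1 : (r : ℝ) < 1 := by exact_mod_cast hr
    have hs := (h (r : ℝ) (by simpa [mem_unitDisk] using hr1)).summable.norm
    refine FormalMultilinearSeries.le_radius_of_summable _ (hs.congr fun n => ?_)
    simp
  · have hy' : y ∈ unitDisk := by
      rw [← ENNReal.coe_one, eball_coe] at hy
      exact hy
    simpa [FormalMultilinearSeries.ofScalars_apply_eq, smul_eq_mul, mul_comm] using h y hy'

theorem differentiableOn_of_hasSum {a : ℕ → ℂ} {F : ℂ → ℂ}
    (h : ∀ z ∈ unitDisk, HasSum (fun n => a n * z ^ n) (F z)) : DifferentiableOn ℂ F unitDisk := by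
  have := (hasFPowerSeriesOnBall_of_hasSum h).differentiableOn
  rwa [← ENNReal.coe_one, eball_coe] at this

theorem eq_coeff_of_hasSum {a b : ℕ → ℂ} {F : ℂ → ℂ}
    (ha : ∀ z ∈ unitDisk, HasSum (fun n => a n * z ^ n) (F z))
    (hb : ∀ z ∈ unitDisk, HasSum (fun n => b n * z ^ n) (F z)) : a = b :=
  FormalMultilinearSeries.ofScalars_series_injective ℂ ℂ
    ((hasFPowerSeriesOnBall_of_hasSum ha).hasFPowerSeriesAt.eq_formalMultilinearSeries
      (hasFPowerSeriesOnBall_of_hasSum hb).hasFPowerSeriesAt)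

theorem hasSum_taylor {F : ℂ → ℂ} (hF : DifferentiableOn ℂ F unitDisk) {z : ℂ}
    (hz : z ∈ unitDisk) :
    HasSum (fun n : ℕ => (n.factorial : ℂ)⁻¹ * iteratedDeriv n F 0 * z ^ n) (F z) := by
  convert! Complex.hasSum_taylorSeries_on_ball hF hz using 2 with n
  simp only [sub_zero, smul_eq_mul]; ring

theorem hasSum_deriv_of_hasSum {a : ℕ → ℂ} {F : ℂ → ℂ}
    (h : ∀ z ∈ unitDisk, HasSum (fun n => a n * z ^ n) (F z)) {z : ℂ} (hz : z ∈ unitDisk) :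
    HasSum (fun n : ℕ => (n + 1) * a (n + 1) * z ^ n) (deriv F z) := by
  have hF := differentiableOn_of_hasSum h
  have ha := eq_coeff_of_hasSum h fun z hz => hasSum_taylor hF hz
  convert! hasSum_taylor (hF.deriv isOpen_unitDisk) hz using 2 with n
  rw [ha, ← iteratedDeriv_succ']
  simp only [Nat.factorial_succ]
  have : (n : ℂ) + 1 ≠ 0 := by exact_mod_cast n.succ_ne_zero
  push_cast
  field_simp

theorem deriv_zero_of_hasSum {a : ℕ → ℂ} {F : ℂ → ℂ}
    (h : ∀ z ∈ unitDisk, HasSum (fun n => a n * z ^ n) (F z)) : deriv F 0 = a 1 := by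
  have h1 := hasSum_deriv_of_hasSum h zero_mem_unitDisk
  have h2 := hasSum_single (f := fun n : ℕ => (n + 1) * a (n + 1) * (0 : ℂ) ^ n) 0
    fun n hn => by simp [hn]
  simpa using h1.unique h2

theorem eq_zero_coeff_of_hasSum {a : ℕ → ℂ} {F : ℂ → ℂ}
    (h : ∀ z ∈ unitDisk, HasSum (fun n => a n * z ^ n) (F z)) : F 0 = a 0 := by
  have h2 := hasSum_single (f := fun n : ℕ => a n * (0 : ℂ) ^ n) 0 fun n hn => by simp [hn]
  simpa using (h 0 zero_mem_unitDisk).unique h2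

theorem hasSum_mul_deriv_of_hasSum {a : ℕ → ℂ} {F : ℂ → ℂ}
    (h : ∀ z ∈ unitDisk, HasSum (fun n => a n * z ^ n) (F z)) {z : ℂ} (hz : z ∈ unitDisk) :
    HasSum (fun n : ℕ => n * a n * z ^ n) (z * deriv F z) := by
  have h1 := (hasSum_deriv_of_hasSum h hz).mul_left z
  rw [← hasSum_nat_add_iff' 1]
  simp only [Finset.sum_range_one, Nat.cast_zero, zero_mul, sub_zero]
  convert! h1 using 2 with n
  push_cast; ring

/-- Parseval's identity on a circle. -/
theorem hasSum_sq_circleAverage {a : ℕ → ℂ} {F : ℂ → ℂ}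
    (h : ∀ z ∈ unitDisk, HasSum (fun n => a n * z ^ n) (F z)) {ρ : ℝ} (hρ0 : 0 ≤ ρ)
    (hρ1 : ρ < 1) :
    HasSum (fun n => (‖a n‖ * ρ ^ n) ^ 2) (Real.circleAverage (fun z => ‖F z‖ ^ 2) 0 ρ) := by
  have hmem : ∀ θ, circleMap 0 ρ θ ∈ unitDisk := fun θ => by
    rw [mem_unitDisk, norm_circleMap_zero, abs_of_nonneg hρ0]; exact hρ1
  have hs : Summable fun n => ‖a n‖ * ρ ^ n := by
    have := (h ρ (by rw [mem_unitDisk, norm_real, Real.norm_of_nonneg hρ0]; exact hρ1)).summable.norm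
    refine this.congr fun n => ?_
    rw [norm_mul, norm_pow, norm_real, Real.norm_of_nonneg hρ0]
  have hpar : ∀ N : ℕ, ∑ n ∈ Finset.range N, (‖a n‖ * ρ ^ n) ^ 2
      = Real.circleAverage (fun z => ‖∑ n ∈ Finset.range N, a n * z ^ n‖ ^ 2) 0 ρ := by
    intro N
    set p : Polynomial ℂ := ∑ n ∈ Finset.range N, Polynomial.monomial n (a n * (ρ : ℂ) ^ n) with hp
    have hcoeff : ∀ n, p.coeff n = if n < N then a n * (ρ : ℂ) ^ n else 0 := fun n => by
      simp [hp, Polynomial.coeff_monomial]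
    have h1 := p.sum_sq_norm_coeff_eq_circleAverage
    rw [Finset.sum_subset (s₂ := Finset.range N)
      (fun n hn => by
        rw [Polynomial.mem_support_iff, hcoeff] at hn
        rw [Finset.mem_range]
        by_contra hlt
        exact hn (if_neg hlt))
      (fun n _ hn => by rw [Polynomial.notMem_support_iff.1 hn]; simp)] at h1
    rw [Real.circleAverage_eq_circleAverage_zero_one]
    refine Eq.trans (Finset.sum_congr rfl fun n hn => ?_) (h1.trans ?_)
    · rw [hcoeff, if_pos (Finset.mem_range.1 hn), norm_mul, norm_pow, norm_real,
        Real.norm_of_nonneg hρ0]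
    · congr 1
      funext z
      simp only [hp, Polynomial.eval_finsetSum, Polynomial.eval_monomial, add_zero]
      congr 2
      refine Finset.sum_congr rfl fun n _ => ?_
      rw [mul_pow]; ring
  rw [hasSum_iff_tendsto_nat_of_nonneg (fun n => by positivity)]
  simp_rw [hpar, Real.circleAverage_def]
  refine Tendsto.const_smul ?_ _
  set C := ∑' n, ‖a n‖ * ρ ^ n with hC
  -- Parseval holds for the partial sums, being polynomials; these are dominated on the circle by `∑
  -- ‖a n‖ ρ^n`.
  refine intervalIntegral.tendsto_integral_filter_of_dominated_convergence (fun _ => C ^ 2) ?_ ?_ ?_ ?_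
  · refine Eventually.of_forall fun N => Continuous.aestronglyMeasurable ?_
    have := continuous_circleMap 0 ρ
    fun_prop
  · refine Eventually.of_forall fun N => Eventually.of_forall fun θ _ => ?_
    rw [Real.norm_of_nonneg (by positivity)]
    refine pow_le_pow_left₀ (norm_nonneg _) ((norm_sum_le _ _).trans ?_) 2
    refine le_trans (Finset.sum_le_sum fun n _ => le_of_eq ?_)
      (hs.sum_le_tsum _ fun n _ => by positivity)
    rw [norm_mul, norm_pow, norm_circleMap_zero, abs_of_nonneg hρ0]
  · exact intervalIntegrable_const
  · refine Eventually.of_forall fun θ _ => ?_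
    exact (((h _ (hmem θ)).tendsto_sum_nat).norm).pow 2

theorem sum_pow_primitiveRoot {m : ℕ} {ε : ℂ} (hε : IsPrimitiveRoot ε m) (n : ℕ) :
    ∑ k ∈ Finset.range m, (ε ^ k) ^ n = if m ∣ n then (m : ℂ) else 0 := by
  simp_rw [← pow_mul, mul_comm _ n, pow_mul]
  split_ifs with hd
  · rw [(hε.pow_eq_one_iff_dvd n).2 hd]; simp
  · have h1 : ε ^ n ≠ 1 := fun h => hd ((hε.pow_eq_one_iff_dvd n).1 h)
    rw [geom_sum_eq h1, ← pow_mul, mul_comm n m, pow_mul, hε.pow_eq_one]; simp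

/-- Rogosinski's theorem: the coefficients of a function subordinate to a convex function are
bounded by the first coefficient of the latter. -/
theorem IsConvexFunction.norm_coeff_le {φ g : ℂ → ℂ} {c : ℕ → ℂ} (hφ : IsConvexFunction φ)
    (hc : ∀ z ∈ unitDisk, HasSum (fun n => c n * z ^ n) (g z)) (h0 : g 0 = φ 0)
    (hg : ∀ z ∈ unitDisk, g z ∈ φ '' unitDisk) {m : ℕ} (hm : m ≠ 0) :
    ‖c m‖ ≤ ‖deriv φ 0‖ := by
  have hε := Complex.isPrimitiveRoot_exp m hm
  set ε := exp (2 * Real.pi * I / m) with hεdef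
  have hεn : ‖ε‖ = 1 := hε.norm'_eq_one hm
  have hmc : (m : ℂ) ≠ 0 := by exact_mod_cast hm
  -- Averaging `g` over rotations by `m`-th roots of unity keeps only exponents divisible by `m`,
  -- and convexity keeps the values in the image of `φ`. The average is `H (y ^ m)`, and `H` has
  -- first coefficient `c m`, so the Schwarz lemma applies to `φ⁻¹ ∘ H`.
  set H : ℂ → ℂ := fun z => ∑' j, c (m * j) * z ^ j with hH
  have key : ∀ y ∈ unitDisk, HasSum (fun j => c (m * j) * (y ^ m) ^ j)
      (∑ k ∈ Finset.range m, (m : ℂ)⁻¹ * g (ε ^ k * y)) := by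
    intro y hy
    have h1 : HasSum (fun n => ∑ k ∈ Finset.range m, (m : ℂ)⁻¹ * (c n * (ε ^ k * y) ^ n))
        (∑ k ∈ Finset.range m, (m : ℂ)⁻¹ * g (ε ^ k * y)) :=
      hasSum_sum fun k _ => (hc _ (mul_mem_unitDisk (by simp [hεn]) hy)).mul_left _
    have h2 : ∀ n, ∑ k ∈ Finset.range m, (m : ℂ)⁻¹ * (c n * (ε ^ k * y) ^ n)
        = if m ∣ n then c n * y ^ n else 0 := by
      intro n
      have h3 : ∀ k ∈ Finset.range m, (m : ℂ)⁻¹ * (c n * (ε ^ k * y) ^ n)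
          = (m : ℂ)⁻¹ * (c n * y ^ n) * (ε ^ k) ^ n := fun k _ => by rw [mul_pow]; ring
      rw [Finset.sum_congr rfl h3, ← Finset.mul_sum, sum_pow_primitiveRoot hε]
      split_ifs
      · field_simp
      · simp
    simp_rw [h2] at h1
    have hinj : Function.Injective fun j => m * j := fun i j hij =>
      Nat.eq_of_mul_eq_mul_left (Nat.pos_of_ne_zero hm) hij
    rw [← hinj.hasSum_iff] at h1
    · convert! h1 using 2 with j
      simp [pow_mul]
    · intro n hn
      rw [if_neg]
      rintro ⟨j, rfl⟩
      exact hn ⟨j, rfl⟩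
  have hHy : ∀ z ∈ unitDisk, HasSum (fun j => c (m * j) * z ^ j) (H z) ∧ H z ∈ φ '' unitDisk := by
    intro z hz
    obtain ⟨y, rfl⟩ := IsAlgClosed.exists_pow_nat_eq z (Nat.pos_of_ne_zero hm)
    have hy : y ∈ unitDisk := by
      rw [mem_unitDisk, norm_pow] at hz
      rw [mem_unitDisk]
      exact (pow_lt_one_iff_of_nonneg (norm_nonneg _) hm).1 hz
    have h1 := key y hy
    refine ⟨h1.summable.hasSum, ?_⟩
    rw [hH]
    simp only [h1.tsum_eq]
    have h2 := hφ.2.2.sum_mem (t := Finset.range m) (w := fun _ => (m : ℝ)⁻¹)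
      (z := fun k => g (ε ^ k * y)) (fun _ _ => by positivity)
      (by simp [hm]) (fun k _ => hg _ (mul_mem_unitDisk (by simp [hεn]) hy))
    simpa only [real_smul, ofReal_inv, ofReal_natCast] using h2
  have hHs := fun z hz => (hHy z hz).1
  have hHd := differentiableOn_of_hasSum hHs
  have hH0 : H 0 = φ 0 := by
    rw [eq_zero_coeff_of_hasSum hHs, mul_zero, ← eq_zero_coeff_of_hasSum hc, h0]
  have hW := isSchwarz_invFunOn_comp hφ.1 hφ.2.1 hHd hH0 fun z hz => (hHy z hz).2
  set W : ℂ → ℂ := fun z => Function.invFunOn φ unitDisk (H z) with hWdef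
  have h1 : deriv H 0 = deriv φ 0 * deriv W 0 := by
    have h2 : H =ᶠ[𝓝 0] φ ∘ W := by
      filter_upwards [isOpen_unitDisk.mem_nhds zero_mem_unitDisk] with z hz
      exact (exists_eq_of_invFunOn (hHy z hz).2).2.symm
    rw [h2.deriv_eq, deriv_comp, hW.2.1]
    · rw [hW.2.1]; exact hφ.1.differentiableAt_unitDisk zero_mem_unitDisk
    · exact hW.1.differentiableAt_unitDisk zero_mem_unitDisk
  rw [deriv_zero_of_hasSum hHs, mul_one] at h1
  rw [h1, norm_mul]
  exact mul_le_of_le_one_right (norm_nonneg _) hW.norm_deriv_le_one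

/-- A Carathéodory function has derivative at most two at the origin. -/
theorem norm_deriv_zero_le_two {φ : ℂ → ℂ} (hφ : DifferentiableOn ℂ φ unitDisk) (h0 : φ 0 = 1)
    (hre : ∀ z ∈ unitDisk, 0 < (φ z).re) : ‖deriv φ 0‖ ≤ 2 := by
  have hne : ∀ z ∈ unitDisk, φ z + 1 ≠ 0 := fun z hz h => by
    have := congrArg re h
    rw [add_re, one_re, zero_re] at this
    linarith [hre z hz]
  have hW : IsSchwarz fun z => (φ z - 1) / (φ z + 1) := by
    refine ⟨(hφ.sub_const 1).div (hφ.add_const 1) hne, by simp [h0], fun z hz => ?_⟩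
    rw [mem_unitDisk, norm_div, div_lt_one (norm_pos_iff.2 (hne z hz))]
    refine lt_of_pow_lt_pow_left₀ 2 (norm_nonneg _) ?_
    rw [← normSq_eq_norm_sq, ← normSq_eq_norm_sq, normSq_apply, normSq_apply]
    simp only [sub_re, add_re, one_re, sub_im, add_im, one_im]
    nlinarith [hre z hz]
  have h1 := hW.norm_deriv_le_one
  have hd := (hφ.differentiableAt_unitDisk zero_mem_unitDisk).hasDerivAt
  have h2 := ((hd.sub_const 1).div (hd.add_const 1) (hne 0 zero_mem_unitDisk)).deriv
  have h3 : deriv (fun z => (φ z - 1) / (φ z + 1)) 0 = deriv φ 0 / 2 := by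
    refine h2.trans ?_
    rw [h0]; ring
  rw [h3, norm_div] at h1
  simp at h1
  linarith

/-! ### The quotient `z f'/f` and logarithmic coefficients -/

theorem starQuot_zero (f : ℂ → ℂ) : starQuot f 0 = 1 := if_pos rfl

theorem hasDerivAt_of_eq_mul_exp {f L : ℂ → ℂ} (hL : DifferentiableOn ℂ L unitDisk)
    (h : ∀ z ∈ unitDisk, f z = z * exp (L z)) {z : ℂ} (hz : z ∈ unitDisk) :
    HasDerivAt f (exp (L z) * (1 + z * deriv L z)) z := by
  have h1 : HasDerivAt (fun z => z * exp (L z)) (1 * exp (L z) + z * (exp (L z) * deriv L z)) z :=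
    (hasDerivAt_id z).mul (hL.differentiableAt_unitDisk hz).hasDerivAt.cexp
  have h2 : f =ᶠ[𝓝 z] fun z => z * exp (L z) := by
    filter_upwards [isOpen_unitDisk.mem_nhds hz] with y hy using h y hy
  exact (h1.congr_of_eventuallyEq h2).congr_deriv (by ring)

theorem starQuot_of_eq_mul_exp {f L : ℂ → ℂ} (hL : DifferentiableOn ℂ L unitDisk)
    (h : ∀ z ∈ unitDisk, f z = z * exp (L z)) {z : ℂ} (hz : z ∈ unitDisk) :
    starQuot f z = 1 + z * deriv L z := by
  rcases eq_or_ne z 0 with rfl | hz0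
  · simp [starQuot_zero]
  · rw [starQuot, if_neg hz0, (hasDerivAt_of_eq_mul_exp hL h hz).deriv, h z hz]
    have := exp_ne_zero (L z)
    field_simp

/-- The holomorphic logarithm of `f z / z`. -/
theorem ClassA.exists_eq_mul_exp {f : ℂ → ℂ} (hf : ClassA f)
    (hne : ∀ z ∈ unitDisk, z ≠ 0 → f z ≠ 0) :
    ∃ L : ℂ → ℂ, DifferentiableOn ℂ L unitDisk ∧ L 0 = 0 ∧ ∀ z ∈ unitDisk, f z = z * exp (L z) := by
  obtain ⟨hd, hf0, hf1⟩ := hf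
  set g := dslope f 0 with hg
  have hgf : ∀ z, z * g z = f z := fun z => by simpa [hf0] using sub_smul_dslope f 0 z
  have hg0 : g 0 = 1 := by rw [hg, dslope_same, hf1]
  have hgne : ∀ z ∈ unitDisk, g z ≠ 0 := by
    intro z hz
    rcases eq_or_ne z 0 with rfl | hz0
    · rw [hg0]; exact one_ne_zero
    · intro h
      apply hne z hz hz0
      rw [← hgf z, h, mul_zero]
  have hgd : DifferentiableOn ℂ g unitDisk :=
    (differentiableOn_dslope (isOpen_unitDisk.mem_nhds zero_mem_unitDisk)).2 hd
  -- `L` is the primitive of `g'/g` vanishing at 0, so `g exp (-L)` is constant.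
  obtain ⟨L, hL0, hL⟩ := (((hgd.deriv isOpen_unitDisk).div hgd hgne).isExactOn_ball).with_val_at 0 0
  have hLd : DifferentiableOn ℂ L unitDisk :=
    fun z hz => (hL z hz).differentiableAt.differentiableWithinAt
  refine ⟨L, hLd, hL0, fun z hz => ?_⟩
  have h1 : ∀ y ∈ unitDisk, HasDerivAt (fun y => g y * exp (-L y)) 0 y := by
    intro y hy
    have h2 := (hgd.differentiableAt_unitDisk hy).hasDerivAt.mul (hL y hy).neg.cexp
    refine h2.congr_deriv ?_
    have := hgne y hy
    simp only [Pi.div_apply, Pi.neg_apply]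
    field_simp
    ring
  have h3 := isOpen_unitDisk.is_const_of_deriv_eq_zero (convex_ball (0 : ℂ) 1).isPreconnected
    (fun y hy => (h1 y hy).differentiableAt.differentiableWithinAt) (fun y hy => (h1 y hy).deriv)
    hz zero_mem_unitDisk
  simp only [hL0, hg0, neg_zero, exp_zero, mul_one] at h3
  rw [← hgf z]
  congr 1
  rw [exp_neg, mul_inv_eq_one₀ (exp_ne_zero _)] at h3
  exact h3

/-- At a zero `z ≠ 0` of `f`, division by zero makes `starQuot f z`, hence the whole expression,
equal to 0, which is not a value of `φ`. -/
theorem ne_zero_of_subordinate_diffExpr {f φ : ℂ → ℂ} (hre : ∀ z ∈ unitDisk, 0 < (φ z).re)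
    (hs : Subordinate (diffExpr f) φ) {z : ℂ} (hz : z ∈ unitDisk) (hz0 : z ≠ 0) : f z ≠ 0 := by
  intro h
  obtain ⟨w, hw, hwf⟩ := hs
  have h1 := hwf z hz
  rw [diffExpr, starQuot, if_neg hz0, h, div_zero, zero_mul] at h1
  have h2 := hre _ (hw.2.2 z hz)
  rw [← h1, zero_re] at h2
  exact lt_irrefl _ h2

theorem diffExpr_eq_sq_add {f : ℂ → ℂ} (hP : DifferentiableOn ℂ (starQuot f) unitDisk) {z : ℂ}
    (hz : z ∈ unitDisk) :
    diffExpr f z = starQuot f z ^ 2 + z * deriv (fun y => starQuot f y ^ 2) z := by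
  have h := ((hP.differentiableAt_unitDisk hz).hasDerivAt.fun_pow 2).deriv
  rw [h, diffExpr]
  push_cast
  ring

theorem differentiableOn_starQuot {f L : ℂ → ℂ} (hL : DifferentiableOn ℂ L unitDisk)
    (h : ∀ z ∈ unitDisk, f z = z * exp (L z)) : DifferentiableOn ℂ (starQuot f) unitDisk :=
  ((differentiableOn_id.mul (hL.deriv isOpen_unitDisk)).const_add 1).congr
    fun _ hz => starQuot_of_eq_mul_exp hL h hz

/-- A path from `P 0 = 1` out of the right half-plane would cross the imaginary axis, where `P²` is
nonpositive. -/
theorem re_pos_of_re_sq_pos {P : ℂ → ℂ} (hP : ContinuousOn P unitDisk) (h0 : P 0 = 1)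
    (hsq : ∀ z ∈ unitDisk, 0 < (P z ^ 2).re) {z : ℂ} (hz : z ∈ unitDisk) : 0 < (P z).re := by
  by_contra! hle
  have h1 := (convex_ball (0 : ℂ) 1).isPreconnected.intermediate_value hz zero_mem_unitDisk
    (continuous_re.comp_continuousOn hP)
  obtain ⟨y, hy, hy0⟩ := h1 (show (0 : ℝ) ∈ Icc (P z).re (P 0).re from ⟨hle, by simp [h0]⟩)
  have h2 := hsq y hy
  simp only [Function.comp_apply] at hy0
  rw [sq, mul_re, hy0] at h2
  nlinarith [mul_self_nonneg (P y).im]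

theorem subordinate_starQuot {f φ : ℂ → ℂ} (hφ : IsConvexFunction φ)
    (hre : ∀ z ∈ unitDisk, 0 < (φ z).re) (hP : DifferentiableOn ℂ (starQuot f) unitDisk)
    (hs : Subordinate (diffExpr f) φ) : Subordinate (starQuot f) (sqrtMean φ) := by
  obtain ⟨w, hw, hwf⟩ := hs
  obtain ⟨v, hv, hvu⟩ := hφ.subordinate_integralMean (u := fun z => starQuot f z ^ 2) (hP.pow 2) hw
    fun z hz => by rw [← hwf z hz, diffExpr_eq_sq_add hP hz]
  have hψ := fun z (hz : z ∈ unitDisk) => re_integralMean_pos hφ.1 hre (hv.2.2 z hz)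
  refine ⟨v, hv, fun z hz => ?_⟩
  refine eq_cpow_half_of_sq_eq ?_ (hψ z hz) (hvu z hz)
  exact re_pos_of_re_sq_pos hP.continuousOn (starQuot_zero f)
    (fun y hy => (hψ y hy).trans_eq (congrArg re (hvu y hy)).symm) hz

theorem exists_isLogCoeffs {f L : ℂ → ℂ} (hL : DifferentiableOn ℂ L unitDisk) (hL0 : L 0 = 0)
    (h : ∀ z ∈ unitDisk, f z = z * exp (L z)) : ∃ γ : ℕ → ℂ, IsLogCoeffs f γ := by
  refine ⟨fun n => (n.factorial : ℂ)⁻¹ * iteratedDeriv n L 0 / 2, L, h, fun z hz => ?_⟩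
  have h1 := hasSum_taylor hL hz
  rw [← hasSum_nat_add_iff' 1] at h1
  simp only [Finset.sum_range_one, iteratedDeriv_zero, hL0, mul_zero, zero_mul, sub_zero] at h1
  convert! h1 using 2 with n
  ring

/-- The logarithmic coefficients determine the Taylor coefficients of `z f' / f`. -/
theorem IsLogCoeffs.hasSum_starQuot {f : ℂ → ℂ} {γ : ℕ → ℂ} (h : IsLogCoeffs f γ) {z : ℂ}
    (hz : z ∈ unitDisk) :
    HasSum (fun n : ℕ => (if n = 0 then 1 else 2 * n * γ n) * z ^ n) (starQuot f z) := by
  obtain ⟨L, hfL, hL⟩ := h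
  have hL' : ∀ z ∈ unitDisk, HasSum (fun n : ℕ => (if n = 0 then 0 else 2 * γ n) * z ^ n) (L z) := by
    intro z hz
    rw [← hasSum_nat_add_iff' 1]
    simpa using hL z hz
  rw [starQuot_of_eq_mul_exp (differentiableOn_of_hasSum hL') hfL hz]
  have h1 := (hasSum_ite_eq (0 : ℕ) (1 : ℂ)).add (hasSum_mul_deriv_of_hasSum hL' hz)
  convert! h1 using 2 with n
  rcases eq_or_ne n 0 with rfl | hn
  · simp
  · simp only [if_neg hn]; ring

/-- Every holomorphic function with value one at the origin is `z f' / f` for some `f` in the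
class. -/
theorem exists_classA_starQuot_eq {P : ℂ → ℂ} (hP : DifferentiableOn ℂ P unitDisk) (h0 : P 0 = 1) :
    ∃ f : ℂ → ℂ, ClassA f ∧ ∀ z ∈ unitDisk, starQuot f z = P z := by
  have hd : DifferentiableOn ℂ (dslope P 0) unitDisk :=
    (differentiableOn_dslope (isOpen_unitDisk.mem_nhds zero_mem_unitDisk)).2 hP
  -- The choice `L' = (P - 1)/z` is forced by `z f'/f = 1 + z L'`.
  obtain ⟨L, hL0, hL⟩ := hd.isExactOn_ball.with_val_at 0 0
  have hLd : DifferentiableOn ℂ L unitDisk :=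
    fun z hz => (hL z hz).differentiableAt.differentiableWithinAt
  have hf : ∀ z ∈ unitDisk, (fun z => z * exp (L z)) z = z * exp (L z) := fun _ _ => rfl
  refine ⟨fun z => z * exp (L z), ⟨fun z hz =>
    (hasDerivAt_of_eq_mul_exp hLd hf hz).differentiableAt.differentiableWithinAt, by simp, ?_⟩,
    fun z hz => ?_⟩
  · rw [(hasDerivAt_of_eq_mul_exp hLd hf zero_mem_unitDisk).deriv]
    simp [hL0]
  · rw [starQuot_of_eq_mul_exp hLd hf hz, (hL z hz).deriv]
    have := sub_smul_dslope P 0 z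
    rw [sub_zero, smul_eq_mul, h0] at this
    rw [this]; ring

theorem subordinate_diffExpr_of_starQuot_eq {f φ : ℂ → ℂ} (hφ : DifferentiableOn ℂ φ unitDisk)
    (hP : DifferentiableOn ℂ (sqrtMean φ) unitDisk)
    (h : ∀ z ∈ unitDisk, starQuot f z = sqrtMean φ z) : Subordinate (diffExpr f) φ := by
  refine ⟨id, ⟨differentiableOn_id, rfl, fun z hz => hz⟩, fun z hz => ?_⟩
  rw [diffExpr_eq_sq_add (hP.congr h) hz, h z hz, sqrtMean, cpow_half_sq, id]
  have h1 : (fun y => starQuot f y ^ 2) =ᶠ[𝓝 z] integralMean φ := by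
    filter_upwards [isOpen_unitDisk.mem_nhds hz] with y hy
    rw [h y hy, sqrtMean, cpow_half_sq]
  rw [h1.deriv_eq, integralMean_add_mul_deriv hφ hz]

/-! ### Mean-square estimate for the coefficients -/

theorem sum_range_one_div_sq_le (N : ℕ) :
    ∑ n ∈ Finset.range N, 1 / ((n : ℝ) + 1) ^ 2 ≤ Real.pi ^ 2 / 6 := by
  have h := (hasSum_nat_add_iff' 1).2 hasSum_zeta_two
  simp only [Finset.sum_range_one, Nat.cast_zero, Nat.cast_add, Nat.cast_one] at h
  norm_num at h
  simpa using sum_le_hasSum (Finset.range N) (fun n _ => by positivity) h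

theorem hasSum_one_div_add_two_sq :
    HasSum (fun n : ℕ => 1 / ((n : ℝ) + 2) ^ 2) (Real.pi ^ 2 / 6 - 1) := by
  have h := (hasSum_nat_add_iff' 2).2 hasSum_zeta_two
  simpa [Finset.sum_range_succ] using h

theorem sum_range_one_div_add_five_sq_le (N : ℕ) :
    ∑ n ∈ Finset.range N, 1 / ((n : ℝ) + 5) ^ 2 ≤ Real.pi ^ 2 / 6 - 205 / 144 := by
  have h := (hasSum_nat_add_iff' 5).2 hasSum_zeta_two
  have h2 := sum_le_hasSum (Finset.range N) (fun n _ => by positivity) h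
  norm_num [Finset.sum_range_succ] at h2
  norm_num
  linarith

theorem circleAverage_sq_le {g : ℂ → ℝ} {ρ : ℝ} (hg : ContinuousOn g (sphere 0 |ρ|)) :
    Real.circleAverage g 0 ρ ^ 2 ≤ Real.circleAverage (fun z => g z ^ 2) 0 ρ := by
  set A := Real.circleAverage g 0 ρ with hA
  have h1 : CircleIntegrable g 0 ρ := ContinuousOn.circleIntegrable' hg
  have h2 : CircleIntegrable (fun z => g z ^ 2) 0 ρ := ContinuousOn.circleIntegrable' (hg.pow 2)
  have h3 : CircleIntegrable (fun z => (2 * A) * g z) 0 ρ :=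
    ContinuousOn.circleIntegrable' (continuousOn_const.mul hg)
  have h4 : CircleIntegrable (fun _ => A ^ 2) 0 ρ := ContinuousOn.circleIntegrable' continuousOn_const
  have h5 : 0 ≤ Real.circleAverage (fun z => (g z - A) ^ 2) 0 ρ :=
    Real.circleAverage_nonneg_of_nonneg fun z _ => sq_nonneg _
  have h6 : (fun z => (g z - A) ^ 2) = fun z => (g z ^ 2 - (2 * A) * g z) + A ^ 2 := by
    funext z; ring
  have h7 : Real.circleAverage (fun z => (2 * A) * g z) 0 ρ = (2 * A) * A :=
    Real.circleAverage_fun_smul (a := 2 * A)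
  rw [h6, Real.circleAverage_fun_add (ContinuousOn.circleIntegrable' (by fun_prop)) h4,
    Real.circleAverage_fun_sub h2 h3, h7, Real.circleAverage_const] at h5
  linarith

/-- A mean square estimate for the Taylor coefficients of a function whose square has Taylor
coefficients of order `b / (n + 1)`. -/
theorem sum_sq_coeff_le_of_sq {P : ℂ → ℂ} {a d : ℕ → ℂ} {b : ℝ}
    (ha : ∀ z ∈ unitDisk, HasSum (fun n => a n * z ^ n) (P z)) (ha0 : a 0 = 1)
    (hd : ∀ z ∈ unitDisk, HasSum (fun n => d n * z ^ n) (P z ^ 2))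
    (hdb : ∀ n, ‖d (n + 1)‖ ≤ b / (n + 2)) (N : ℕ) :
    ∑ n ∈ Finset.range N, ‖a (n + 1)‖ ^ 2 ≤ √(1 + (Real.pi ^ 2 / 6 - 1) * b ^ 2) - 1 := by
  have hd0 : d 0 = 1 := by
    rw [← eq_zero_coeff_of_hasSum hd, eq_zero_coeff_of_hasSum ha, ha0, one_pow]
  have key : ∀ ρ ∈ Ioo (0 : ℝ) 1, ∑ n ∈ Finset.range N, (‖a (n + 1)‖ * ρ ^ (n + 1)) ^ 2
      ≤ √(1 + (Real.pi ^ 2 / 6 - 1) * b ^ 2) - 1 := by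
    intro ρ hρ
    have h1 := hasSum_sq_circleAverage ha hρ.1.le hρ.2
    have h2 := hasSum_sq_circleAverage hd hρ.1.le hρ.2
    have hP : ContinuousOn P (sphere 0 |ρ|) :=
      (differentiableOn_of_hasSum ha).continuousOn.mono fun z hz => by
        rw [mem_sphere_zero_iff_norm, abs_of_pos hρ.1] at hz
        rw [mem_unitDisk, hz]; exact hρ.2
    set A := Real.circleAverage (fun z => ‖P z‖ ^ 2) 0 ρ with hA
    -- This passes from `P` to `P²`: the squared mean of `‖P‖²` is at most the mean of `‖P‖⁴`, which
    -- Parseval expresses through `d`.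
    have h3 : A ^ 2 ≤ Real.circleAverage (fun z => (‖P z‖ ^ 2) ^ 2) 0 ρ :=
      circleAverage_sq_le (hP.norm.pow 2)
    have h4 : Real.circleAverage (fun z => ‖P z ^ 2‖ ^ 2) 0 ρ
        ≤ 1 + (Real.pi ^ 2 / 6 - 1) * b ^ 2 := by
      have h5 := (hasSum_nat_add_iff' 1).2 h2
      simp only [Finset.sum_range_one, hd0, norm_one, pow_zero, mul_one, one_pow] at h5
      have h6 := hasSum_one_div_add_two_sq.mul_right (b ^ 2)
      have h7 := hasSum_le (fun n => ?_) h5 h6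
      · linarith
      · rw [one_div_mul_eq_div, ← div_pow]
        refine pow_le_pow_left₀ (mul_nonneg (norm_nonneg _) (pow_nonneg hρ.1.le _)) ?_ 2
        exact (mul_le_of_le_one_right (norm_nonneg _) (pow_le_one₀ hρ.1.le hρ.2.le)).trans (hdb n)
    have h8 : A ≤ √(1 + (Real.pi ^ 2 / 6 - 1) * b ^ 2) := by
      refine Real.le_sqrt_of_sq_le (le_trans ?_ h4)
      simpa only [norm_pow] using h3
    have h9 := sum_le_hasSum (Finset.range (N + 1)) (fun n _ => sq_nonneg _) h1
    rw [Finset.sum_range_succ', ha0] at h9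
    simp only [norm_one, pow_zero, mul_one, one_pow] at h9
    linarith
  have hlim : Tendsto (fun ρ : ℝ => ∑ n ∈ Finset.range N, (‖a (n + 1)‖ * ρ ^ (n + 1)) ^ 2)
      (𝓝[<] 1) (𝓝 (∑ n ∈ Finset.range N, (‖a (n + 1)‖ * 1 ^ (n + 1)) ^ 2)) :=
    (Continuous.tendsto (by fun_prop) 1).mono_left nhdsWithin_le_nhds
  simp only [one_pow, mul_one] at hlim
  refine le_of_tendsto hlim ?_
  filter_upwards [Ioo_mem_nhdsLT (one_pos : (0 : ℝ) < 1)] with ρ hρ using key ρ hρ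

/-! ### Numerical estimates -/

theorem sum_pow_div_sq_le_of_le_one {r : ℝ} (h0 : 0 ≤ r) (h1 : r ≤ 1) (N : ℕ) :
    ∑ n ∈ Finset.range N, (r ^ (n + 1) / (n + 1)) ^ 2 ≤ Real.pi ^ 2 / 6 := by
  refine le_trans (Finset.sum_le_sum fun n _ => ?_) (sum_range_one_div_sq_le N)
  rw [div_pow]
  gcongr
  exact pow_le_one₀ (by positivity) (pow_le_one₀ h0 h1)

/-- Four terms are kept exactly; in the tail `y^n ≤ y^5`, and `205/144 = 1 + 1/4 + 1/9 + 1/16` is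
what those terms remove from `π²/6`. -/
theorem sum_pow_div_sq_le {r y : ℝ} (hry : r ^ 2 ≤ y) (hy : y ≤ 1) (N : ℕ) :
    ∑ n ∈ Finset.range N, (r ^ (n + 1) / (n + 1)) ^ 2
      ≤ y + y ^ 2 / 4 + y ^ 3 / 9 + y ^ 4 / 16 + y ^ 5 * (Real.pi ^ 2 / 6 - 205 / 144) := by
  have hy0 : 0 ≤ y := (sq_nonneg r).trans hry
  have hterm : ∀ n : ℕ, (r ^ (n + 1) / (n + 1)) ^ 2 ≤ y ^ (n + 1) / ((n : ℝ) + 1) ^ 2 := fun n => by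
    rw [div_pow, ← pow_mul, mul_comm (n + 1) 2, pow_mul]
    gcongr
  calc _ ≤ ∑ n ∈ Finset.range (4 + N), (r ^ (n + 1) / ((n : ℝ) + 1)) ^ 2 :=
        Finset.sum_le_sum_of_subset_of_nonneg (Finset.range_mono (by omega))
          fun n _ _ => sq_nonneg _
    _ ≤ ∑ n ∈ Finset.range (4 + N), y ^ (n + 1) / ((n : ℝ) + 1) ^ 2 :=
        Finset.sum_le_sum fun n _ => hterm n
    _ = y + y ^ 2 / 4 + y ^ 3 / 9 + y ^ 4 / 16
        + ∑ n ∈ Finset.range N, y ^ (4 + n + 1) / (((4 + n : ℕ) : ℝ) + 1) ^ 2 := by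
        rw [Finset.sum_range_add]
        congr 1
        norm_num [Finset.sum_range_succ]
    _ ≤ _ := by
        have h2 : ∑ n ∈ Finset.range N, y ^ (4 + n + 1) / (((4 + n : ℕ) : ℝ) + 1) ^ 2
            ≤ ∑ n ∈ Finset.range N, y ^ 5 * (1 / ((n : ℝ) + 5) ^ 2) := by
          refine Finset.sum_le_sum fun n _ => ?_
          have h3 : y ^ (4 + n + 1) ≤ y ^ 5 := pow_le_pow_of_le_one hy0 hy (by omega)
          have h4 : (((4 + n : ℕ) : ℝ) + 1) = (n : ℝ) + 5 := by push_cast; ring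
          rw [h4, mul_one_div]
          gcongr
        rw [← Finset.mul_sum] at h2
        have h5 := mul_le_mul_of_nonneg_left (sum_range_one_div_add_five_sq_le N)
          (pow_nonneg hy0 5)
        linarith

/-- `8/3 = 4/1.5`, and `20/9 = 4/1.8` below; an integer power reduces each bound to one for `e⁻¹`.
-/
theorem exp_neg_eight_thirds_ge : (0.0694 : ℝ) ≤ Real.exp (-(8 / 3)) := by
  refine le_of_pow_le_pow_left₀ three_ne_zero (Real.exp_pos _).le ?_
  have h1 : Real.exp (-(8 / 3)) ^ 3 = Real.exp (-1) ^ 8 := by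
    rw [← Real.exp_nat_mul, ← Real.exp_nat_mul]; norm_num
  rw [h1]
  refine le_trans ?_ (pow_le_pow_left₀ (by norm_num) Real.exp_neg_one_gt_d9.le 8)
  norm_num

theorem exp_neg_twenty_ninths_ge : (0.1083 : ℝ) ≤ Real.exp (-(20 / 9)) := by
  refine le_of_pow_le_pow_left₀ (n := 9) (by norm_num) (Real.exp_pos _).le ?_
  have h1 : Real.exp (-(20 / 9)) ^ 9 = Real.exp (-1) ^ 20 := by
    rw [← Real.exp_nat_mul, ← Real.exp_nat_mul]; norm_num
  rw [h1]
  refine le_trans ?_ (pow_le_pow_left₀ (by norm_num) Real.exp_neg_one_gt_d9.le 20)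
  norm_num

theorem sqrt_one_add_sub_one_mul_le_one {b r : ℝ} (hb0 : 0 < b) (hb2 : b ≤ 2) (hr0 : 0 ≤ r)
    (hr : r ≤ 1 - Real.exp (-(4 / b))) (N : ℕ) :
    (√(1 + (Real.pi ^ 2 / 6 - 1) * b ^ 2) - 1)
      * ∑ n ∈ Finset.range N, (r ^ (n + 1) / (n + 1)) ^ 2 ≤ 1 := by
  have hpi : Real.pi ^ 2 ≤ 9.86966 := by
    have h1 := Real.pi_lt_d6
    have h2 := Real.pi_pos
    nlinarith
  have hr1 : r ≤ 1 := hr.trans (by linarith [Real.exp_pos (-(4 / b))])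
  have hT0 : 0 ≤ ∑ n ∈ Finset.range N, (r ^ (n + 1) / ((n : ℝ) + 1)) ^ 2 :=
    Finset.sum_nonneg fun n _ => sq_nonneg _
  have hS : ∀ s b₀ : ℝ, 0 ≤ s → b ≤ b₀ → 1 + 0.644944 * b₀ ^ 2 ≤ s ^ 2 →
      √(1 + (Real.pi ^ 2 / 6 - 1) * b ^ 2) - 1 ≤ s - 1 := by
    intro s b₀ hs hb hle
    have h1 : b ^ 2 ≤ b₀ ^ 2 := pow_le_pow_left₀ hb0.le hb 2
    have h2 : (Real.pi ^ 2 / 6 - 1) * b ^ 2 ≤ 0.644944 * b ^ 2 :=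
      mul_le_mul_of_nonneg_right (by linarith) (sq_nonneg b)
    have := Real.sqrt_le_sqrt (show 1 + (Real.pi ^ 2 / 6 - 1) * b ^ 2 ≤ s ^ 2 by linarith)
    rw [Real.sqrt_sq hs] at this
    linarith
  have hexp : ∀ x e : ℝ, 4 / b ≤ x → e ≤ Real.exp (-x) → e ≤ 1 → r ^ 2 ≤ (1 - e) ^ 2 := by
    intro x e hx he he1
    refine pow_le_pow_left₀ hr0 ?_ 2
    have := Real.exp_le_exp.2 (neg_le_neg hx)
    linarith
  have hfin : ∀ s T : ℝ, √(1 + (Real.pi ^ 2 / 6 - 1) * b ^ 2) - 1 ≤ s →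
      ∑ n ∈ Finset.range N, (r ^ (n + 1) / ((n : ℝ) + 1)) ^ 2 ≤ T → 0 ≤ s → s * T ≤ 1 →
      (√(1 + (Real.pi ^ 2 / 6 - 1) * b ^ 2) - 1)
        * ∑ n ∈ Finset.range N, (r ^ (n + 1) / (n + 1)) ^ 2 ≤ 1 :=
    fun s T h1 h2 h3 h4 => (mul_le_mul h1 h2 hT0 h3).trans h4
  -- The square root grows with `b` while the radius shrinks, so each range takes the root at its
  -- right end and the radius at its left end. Up to `1.5` the crude bound `r ≤ 1` suffices.
  rcases le_total b 1.5 with h1 | h1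
  · exact hfin (1.566 - 1) (Real.pi ^ 2 / 6) (hS 1.566 1.5 (by norm_num) h1 (by norm_num))
      (sum_pow_div_sq_le_of_le_one hr0 hr1 N) (by norm_num) (by linarith)
  rcases le_total b 1.8 with h2 | h2
  · refine hfin (1.758 - 1) _ (hS 1.758 1.8 (by norm_num) h2 (by norm_num))
      (sum_pow_div_sq_le (hexp (8 / 3) 0.0694 ?_ exp_neg_eight_thirds_ge (by norm_num))
        (by norm_num) N) (by norm_num) (by norm_num; linarith)
    rw [div_le_div_iff₀ hb0 (by norm_num)]; linarith
  · refine hfin (1.8925 - 1) _ (hS 1.8925 2 (by norm_num) hb2 (by norm_num))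
      (sum_pow_div_sq_le (hexp (20 / 9) 0.1083 ?_ exp_neg_twenty_ninths_ge (by norm_num))
        (by norm_num) N) (by norm_num) (by norm_num; linarith)
    rw [div_le_div_iff₀ hb0 (by norm_num)]; linarith

/-! ### The Bohr inequality and sharpness -/

/-- The Bohr inequality for the primitive of `(P - 1) / z`. -/
theorem sum_coeff_div_mul_pow_le_one {P : ℂ → ℂ} {a d : ℕ → ℂ} {b r : ℝ} (hb0 : 0 < b) (hb2 : b ≤ 2)
    (ha : ∀ z ∈ unitDisk, HasSum (fun n => a n * z ^ n) (P z)) (ha0 : a 0 = 1)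
    (hd : ∀ z ∈ unitDisk, HasSum (fun n => d n * z ^ n) (P z ^ 2))
    (hdb : ∀ n, ‖d (n + 1)‖ ≤ b / (n + 2)) (hr0 : 0 ≤ r)
    (hr : r ≤ 1 - Real.exp (-(4 / b))) (N : ℕ) :
    ∑ n ∈ Finset.range N, ‖a (n + 1)‖ * (r ^ (n + 1) / (n + 1)) ≤ 1 := by
  have h1 := Finset.sum_mul_sq_le_sq_mul_sq (Finset.range N) (fun n => ‖a (n + 1)‖)
    (fun n => r ^ (n + 1) / ((n : ℝ) + 1))
  have h2 := mul_le_mul_of_nonneg_right (sum_sq_coeff_le_of_sq ha ha0 hd hdb N)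
    (Finset.sum_nonneg fun n (_ : n ∈ Finset.range N) => sq_nonneg (r ^ (n + 1) / ((n : ℝ) + 1)))
  have h3 := sqrt_one_add_sub_one_mul_le_one hb0 hb2 hr0 hr N
  exact (abs_le.1 ((sq_le_one_iff_abs_le_one _).1 (h1.trans (h2.trans h3)))).2

theorem summable_and_tsum_logCoeffs_le_one {φ f : ℂ → ℂ} (hφ : IsConvexFunction φ) (h0 : φ 0 = 1)
    (hre : ∀ z ∈ unitDisk, 0 < (φ z).re) (hs : Subordinate (diffExpr f) φ) {γ : ℕ → ℂ}
    (hγ : IsLogCoeffs f γ) {r : ℝ} (hr0 : 0 ≤ r)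
    (hr : r ≤ 1 - Real.exp (-(4 / ‖deriv φ 0‖))) :
    Summable (fun m : ℕ => ‖γ (m + 1)‖ * r ^ (m + 1)) ∧
      2 * ∑' m : ℕ, ‖γ (m + 1)‖ * r ^ (m + 1) ≤ 1 := by
  obtain ⟨w, hw, hwf⟩ := hs
  have ha := fun z (hz : z ∈ unitDisk) => hγ.hasSum_starQuot hz
  have hP := differentiableOn_of_hasSum ha
  have hd := fun z (hz : z ∈ unitDisk) => hasSum_taylor (F := fun z => starQuot f z ^ 2) (hP.pow 2) hz
  set d : ℕ → ℂ := fun n =>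
    (n.factorial : ℂ)⁻¹ * iteratedDeriv n (fun z => starQuot f z ^ 2) 0 with hddef
  -- In `u + z u'` the coefficient `d n` is multiplied by `n + 1`; Rogosinski's bound on the product
  -- gives the decay of `d`.
  have hg : ∀ z ∈ unitDisk, HasSum (fun n : ℕ => ((n + 1) * d n) * z ^ n) (φ (w z)) := by
    intro z hz
    rw [← hwf z hz, diffExpr_eq_sq_add hP hz]
    convert! (hd z hz).add (hasSum_mul_deriv_of_hasSum hd hz) using 2 with n
    ring
  have hdb : ∀ n, ‖d (n + 1)‖ ≤ ‖deriv φ 0‖ / (n + 2) := by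
    intro n
    have h1 := hφ.norm_coeff_le (g := fun z => φ (w z)) hg (by rw [hw.2.1])
      (fun z hz => mem_image_of_mem φ (hw.2.2 z hz)) n.succ_ne_zero
    rw [le_div_iff₀ (by positivity), mul_comm]
    rw [norm_mul] at h1
    have h2 : ‖((n + 1 : ℕ) : ℂ) + 1‖ = (n : ℝ) + 2 := by
      have : ((n + 1 : ℕ) : ℂ) + 1 = ((n + 2 : ℕ) : ℂ) := by push_cast; ring
      rw [this, norm_natCast]; push_cast; ring
    rwa [h2] at h1
  have hsum : ∀ N, ∑ m ∈ Finset.range N, ‖γ (m + 1)‖ * r ^ (m + 1) ≤ 1 / 2 := by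
    intro N
    have h1 := sum_coeff_div_mul_pow_le_one (norm_pos_iff.2 (hφ.deriv_ne_zero zero_mem_unitDisk))
      (norm_deriv_zero_le_two hφ.1 h0 hre) ha (if_pos rfl) hd hdb hr0 hr N
    have h2 : ∀ n ∈ Finset.range N, ‖if n + 1 = 0 then (1 : ℂ) else 2 * (n + 1 : ℕ) * γ (n + 1)‖
        * (r ^ (n + 1) / (n + 1)) = 2 * (‖γ (n + 1)‖ * r ^ (n + 1)) := by
      intro n _
      rw [if_neg n.succ_ne_zero, norm_mul, norm_mul, norm_natCast]
      simp only [Complex.norm_ofNat, Nat.cast_add, Nat.cast_one]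
      have : (n : ℝ) + 1 ≠ 0 := by positivity
      field_simp
    rw [Finset.sum_congr rfl h2, ← Finset.mul_sum] at h1
    linarith
  have hnn : ∀ m : ℕ, 0 ≤ ‖γ (m + 1)‖ * r ^ (m + 1) := fun m => by positivity
  refine ⟨summable_of_sum_range_le hnn hsum, ?_⟩
  linarith [Real.tsum_le_of_sum_range_le hnn hsum]

/-- Twice the sum equals `-(b/4) log (1 - r)`, which passes 1 exactly at `r = 1 - exp (-4/b)`. -/
theorem summable_and_one_lt_tsum_of_norm_eq {γ : ℕ → ℂ} {b r : ℝ} (hb : 0 < b)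
    (hγ : ∀ m : ℕ, 1 ≤ m → ‖γ m‖ = b / (8 * m)) (hr : 1 - Real.exp (-(4 / b)) < r) (hr1 : r < 1) :
    Summable (fun m : ℕ => ‖γ (m + 1)‖ * r ^ (m + 1)) ∧
      1 < 2 * ∑' m : ℕ, ‖γ (m + 1)‖ * r ^ (m + 1) := by
  have hr0 : 0 < r := by
    have : Real.exp (-(4 / b)) < 1 := Real.exp_lt_one_iff.2 (neg_neg_of_pos (by positivity))
    linarith
  have h1 := (Real.hasSum_pow_div_log_of_abs_lt_one
    (show |r| < 1 by rwa [abs_of_pos hr0])).mul_left (b / 8)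
  have h2 : (fun m : ℕ => ‖γ (m + 1)‖ * r ^ (m + 1)) = fun n : ℕ => b / 8 * (r ^ (n + 1) / (n + 1)) := by
    funext m
    rw [hγ (m + 1) (by omega)]
    push_cast
    field_simp
  rw [h2]
  refine ⟨h1.summable, ?_⟩
  rw [h1.tsum_eq]
  have h3 : Real.log (1 - r) < -(4 / b) := by
    rw [Real.log_lt_iff_lt_exp (by linarith)]; linarith
  have h4 : b / 8 * (4 / b) < b / 8 * -Real.log (1 - r) :=
    mul_lt_mul_of_pos_left (by linarith) (by positivity)
  have h5 : b / 8 * (4 / b) = 1 / 2 := by field_simp; norm_num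
  linarith

theorem mainTheorem9
    (φ : ℂ → ℂ) (hφ : IsConvexFunction φ) (hre : ∀ z ∈ unitDisk, 0 < (φ z).re)
    (B : ℕ → ℂ) (hB : ∀ z ∈ unitDisk, HasSum (fun n : ℕ => B n * z ^ n) (φ z))
    (hB0 : B 0 = 1) (hB1 : B 1 ≠ 0) :
    -- the mean is a convex Caratheodory function, its root is a univalent Caratheodory function
    (IsConvexFunction (integralMean φ) ∧ IsCaratheodory (integralMean φ)) ∧
    (InjOn (sqrtMean φ) unitDisk ∧ IsCaratheodory (sqrtMean φ)) ∧
    -- the subordination and the Bohr inequality for every function of the class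
    (∀ f : ℂ → ℂ, ClassA f → Subordinate (diffExpr f) φ →
      Subordinate (starQuot f) (sqrtMean φ) ∧
      (∃ γ : ℕ → ℂ, IsLogCoeffs f γ) ∧
      ∀ γ : ℕ → ℂ, IsLogCoeffs f γ →
        ∀ r : ℝ, 0 ≤ r → r ≤ 1 - Real.exp (-(4 / ‖B 1‖)) →
          Summable (fun m : ℕ => ‖γ (m + 1)‖ * r ^ (m + 1)) ∧
          2 * ∑' m : ℕ, ‖γ (m + 1)‖ * r ^ (m + 1) ≤ 1) ∧
    -- the candidate extremal function belongs to the class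
    (∃ f₀ : ℂ → ℂ, ClassA f₀ ∧ (∀ z ∈ unitDisk, starQuot f₀ z = sqrtMean φ z) ∧
      Subordinate (diffExpr f₀) φ) ∧
    -- if it attains the coefficient bounds, the radius cannot be enlarged
    (∀ f₀ : ℂ → ℂ, ClassA f₀ → (∀ z ∈ unitDisk, starQuot f₀ z = sqrtMean φ z) →
      ∀ γ : ℕ → ℂ, IsLogCoeffs f₀ γ →
        (∀ m : ℕ, 1 ≤ m → ‖γ m‖ = ‖B 1‖ / (8 * m)) →
        ∀ r : ℝ, 1 - Real.exp (-(4 / ‖B 1‖)) < r → r < 1 →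
          Summable (fun m : ℕ => ‖γ (m + 1)‖ * r ^ (m + 1)) ∧
          1 < 2 * ∑' m : ℕ, ‖γ (m + 1)‖ * r ^ (m + 1)) := by
  have h0 : φ 0 = 1 := by rw [eq_zero_coeff_of_hasSum hB, hB0]
  have h1 : deriv φ 0 = B 1 := deriv_zero_of_hasSum hB
  have hsqrt := isCaratheodory_sqrtMean hφ.1 h0 hre
  refine ⟨⟨hφ.integralMean, isCaratheodory_integralMean hφ.1 h0 hre⟩,
    ⟨hφ.injOn_sqrtMean, hsqrt⟩, fun f hf hs => ?_, ?_, fun f₀ _ _ γ _ hγ r hr hr1 =>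
      summable_and_one_lt_tsum_of_norm_eq (norm_pos_iff.2 hB1) hγ hr hr1⟩
  · obtain ⟨L, hL, hL0, hfL⟩ := hf.exists_eq_mul_exp
      fun z hz hz0 => ne_zero_of_subordinate_diffExpr hre hs hz hz0
    exact ⟨subordinate_starQuot hφ hre (differentiableOn_starQuot hL hfL) hs,
      exists_isLogCoeffs hL hL0 hfL, fun γ hγ r hr0 hr =>
        summable_and_tsum_logCoeffs_le_one hφ h0 hre hs hγ hr0 (by rwa [h1])⟩
  · obtain ⟨f₀, hf₀, hP⟩ := exists_classA_starQuot_eq hsqrt.1 hsqrt.2.1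
    exact ⟨f₀, hf₀, hP, subordinate_diffExpr_of_starQuot_eq hφ.1 hsqrt.1 hP⟩
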